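/- Let $N\ge 1$ be an integer and let $\mathscr D(N)$ be the set of its positive divisors. Let $\widetilde{\Gamma_0(N)}$ be the double cover of $\Gamma_0(N)$, that is, the group of pairs $(\gamma,\varphi)$ with $\gamma=\begin{pmatrix}a&b\\c&d\end{pmatrix}\in\Gamma_0(N)$ and $\varphi(\tau)=\varepsilon\,(c\tau+d)^{1/2}$ (principal branch, $\tau$ in the upper half plane, $\varepsilon^2=1$), with the product $(\gamma_1,\varphi_1(\tau))(\gamma_2,\varphi_2(\tau))=(\gamma_1\gamma_2,\varphi_1(\gamma_2\tau)\varphi_2(\tau))$. For $\mathbf r=(r_n)\in\mathbb Z^{\mathscr D(N)}$ put $f_{\mathbf r}(\tau)=\prod_{n\mid N}\eta(n\tau)^{r_n}$, where $\eta$ is the Dedekind eta function, an eta-quotient of level $N$ and weight $k=\frac12\sum_{n\mid N} r_n$. A character of $f_{\mathbf r}$ is a unitary character $\chi$ of $\widetilde{\Gamma_0(N)}$ with $\varphi(\tau)^{-2k}f_{\mathbf r}(\gamma\tau)=\chi(\gamma,\varphi)f_{\mathbf r}(\tau)$ for all $(\gamma,\varphi)\in\widetilde{\Gamma_0(N)}$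 and all $\tau$. For $k\in\frac12\mathbb Z$ let $S(N,k)=\{\mathbf r\in\mathbb Z^{\mathscr D(N)}:\sum_n r_n=2k\}$, let $S(N)=S(N,0)$, and let $Z(N)\subseteq S(N)$ be the subgroup of those $\mathbf r$ with $\sum_n n r_n\equiv 0\pmod{24}$, $\sum_n \frac Nn r_n\equiv0\pmod{24}$ and $\prod_{2\nmid r_n}n$ a perfect square. Let $\mathscr S(N)=S(N)/Z(N)$, and let $e_n$ ($n\mid N$) be the standard basis of $\mathbb Z^{\mathscr D(N)}$. Let $\mathscr B_N=\bigcup_{p\mid N}\mathscr B_N^p$ ($p$ prime), where $\mathscr B_N^p=\{p\}$ for $p\ge5$; $\mathscr B_N^2=\{2\}$, $\{2,4\}$ or $\{2^{\alpha-2},2^{\alpha-1},2^\alpha\}$ according as $\alpha=v_2(N)$ is $1$, $2$ or $\ge3$; and $\mathscr B_N^3=\{3\}$ or $\{3^{\alpha-1},3^\alpha\}$ according as $\alpha=v_3(N)$ is $1$ or $\ge2$. Consider, for integers $(c_n)_{n\in\mathscr B_N}$, the system $$\sum_{n\in\mathscr B_N}(n-1)c_n\equiv0,\quad \sum_{n\in\mathscr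 B_N}\Bigl(\frac Nn-N\Bigr)c_n\equiv0\pmod{24},\qquad c_p\equiv0\pmod 2\ \text{ for all primes } p\mid N,\ p\ne2,3,$$ $$\sum_{2^\beta\in\mathscr B_N,\,2\nmid c_{2^\beta}}\beta\equiv0,\qquad \sum_{3^\beta\in\mathscr B_N,\,2\nmid c_{3^\beta}}\beta\equiv0\pmod 2.\qquad(*)$$ For an ordering $b_1,\dots,b_t$ of $\mathscr B_N$ let $\Delta_i$ be the least integer $1\le m\le24$ such that $(*)$ has a solution with $c_{b_j}=0$ for $j<i$ and $c_{b_i}=m$. Then for every $N\ge1$: (1) Every $f_{\mathbf r}$, $\mathbf r\in\mathbb Z^{\mathscr D(N)}$, has exactly one character $\chi_{\mathbf r}$, and for $k\in\frac12\mathbb Z$ and $\mathbf r,\mathbf r'\in S(N,k)$ we have $\chi_{\mathbf r}=\chi_{\mathbf r'}$ if and only if $\mathbf r-\mathbf r'\in Z(N)$. In particular $\mathscr S(N)$ is the group of characters of eta-quotients of level $N$ and weight $0$ with integral exponents. (2) For every ordering of $\mathscr B_N$, the vectors $\sum_{j}c_{b_j}e_{b_j}-\bigl(\sum_{j}c_{b_j}\bigr)e_1$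 with integers $0\le c_{b_j}<\Delta_j$ form a complete system of representatives of $\mathscr S(N)$. (3) For every ordering of $\mathscr B_N$ and every $k\in\frac12\mathbb Z$, the map $\mathbf r\mapsto\chi_{\mathbf r}$ is a one-to-one correspondence between the vectors $\sum_{j}r_{b_j}e_{b_j}+\bigl(2k-\sum_{j}r_{b_j}\bigr)e_1$ with integers $0\le r_{b_j}<\Delta_j$ and the characters of eta-quotients of level $N$ and weight $k$ with integral exponents. Moreover, for every $\alpha\ge3$ and every $k\in\frac12\mathbb Z$ there are exactly $384$ characters of eta-quotients of level $2^\alpha$ and weight $k$ with integral exponents. -/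

import Mathlib

open scoped MatrixGroups

noncomputable section

namespace EtaChar

/-! ### The double cover of the modular group -/

/-- The automorphy factor `c τ + d`. -/
def autFactor (γ : SL(2, ℤ)) (τ : UpperHalfPlane) : ℂ := (γ 1 0 : ℂ) * (τ : ℂ) + (γ 1 1 : ℂ)

/-- The principal branch of `(c τ + d) ^ (1 / 2)`, argument in `(-π / 2, π / 2]`. -/
def sqrtFactor (γ : SL(2, ℤ)) (τ : UpperHalfPlane) : ℂ := autFactor γ τ ^ (1 / 2 : ℂ)

theorem autFactor_eq_denom (γ : SL(2, ℤ)) (τ : UpperHalfPlane) :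
    autFactor γ τ = UpperHalfPlane.denom γ τ := by
  simp [autFactor, UpperHalfPlane.denom]

theorem autFactor_ne_zero (γ : SL(2, ℤ)) (τ : UpperHalfPlane) : autFactor γ τ ≠ 0 := by
  rw [autFactor_eq_denom]
  exact UpperHalfPlane.denom_ne_zero _ _

theorem autFactor_mul (γ₁ γ₂ : SL(2, ℤ)) (τ : UpperHalfPlane) :
    autFactor (γ₁ * γ₂) τ = autFactor γ₁ (γ₂ • τ) * autFactor γ₂ τ := by
  have h := UpperHalfPlane.denom_cocycle_σ (γ₁ : GL (Fin 2) ℝ) (γ₂ : GL (Fin 2) ℝ) τ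
  simp only [autFactor_eq_denom, map_mul]
  rw [h]
  simp [UpperHalfPlane.σ]

theorem autFactor_one (τ : UpperHalfPlane) : autFactor 1 τ = 1 := by
  simp [autFactor]

theorem sqrtFactor_sq (γ : SL(2, ℤ)) (τ : UpperHalfPlane) :
    sqrtFactor γ τ ^ 2 = autFactor γ τ := by
  rw [sqrtFactor, ← Complex.cpow_nat_mul]
  simp

theorem sqrtFactor_ne_zero (γ : SL(2, ℤ)) (τ : UpperHalfPlane) : sqrtFactor γ τ ≠ 0 := by
  intro h
  apply autFactor_ne_zero γ τ
  rw [← sqrtFactor_sq, h]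
  simp

theorem continuous_smul_SL (γ : SL(2, ℤ)) : Continuous fun τ : UpperHalfPlane => γ • τ :=
  continuous_const_smul (γ : GL (Fin 2) ℝ)

theorem continuous_autFactor (γ : SL(2, ℤ)) : Continuous (autFactor γ) := by
  unfold autFactor
  fun_prop

theorem continuous_sqrtFactor (γ : SL(2, ℤ)) : Continuous (sqrtFactor γ) := by
  by_cases hc : γ 1 0 = 0
  · have : sqrtFactor γ = fun _ => ((γ 1 1 : ℤ) : ℂ) ^ (1 / 2 : ℂ) := by
      ext τ
      simp [sqrtFactor, autFactor, hc]
    rw [this]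
    exact continuous_const
  · refine (continuous_autFactor γ).cpow continuous_const fun τ => ?_
    refine Or.inr ?_
    have hτ := τ.im_pos
    simp [autFactor, hc, hτ.ne']

/-- A continuous square root of `c τ + d` on the upper half plane is the principal one up to a
constant sign. -/
theorem eq_sign_mul_sqrtFactor (γ : SL(2, ℤ)) (φ : UpperHalfPlane → ℂ) (hφ : Continuous φ)
    (hsq : ∀ τ, φ τ ^ 2 = autFactor γ τ) :
    ∃ ε : ℂ, ε ^ 2 = 1 ∧ ∀ τ, φ τ = ε * sqrtFactor γ τ := by
  have h := IsPreconnected.eq_or_eq_neg_of_sq_eq (S := Set.univ) (f := φ) (g := sqrtFactor γ)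
    isPreconnected_univ hφ.continuousOn (continuous_sqrtFactor γ).continuousOn
    (fun τ _ => by simp [hsq, sqrtFactor_sq]) (fun {τ} _ => sqrtFactor_ne_zero γ τ)
  rcases h with h | h
  · exact ⟨1, by simp, fun τ => by simpa using h (Set.mem_univ τ)⟩
  · exact ⟨-1, by simp, fun τ => by simpa using h (Set.mem_univ τ)⟩

/-- The double cover of `SL(2, ℤ)`: pairs `(γ, ε (c τ + d) ^ (1 / 2))` with `ε ^ 2 = 1`, where the
second entry is a function of `τ` in the upper half plane. -/
@[ext]
structure DoubleCover where
  mat : SL(2, ℤ)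
  root : UpperHalfPlane → ℂ
  exists_sign : ∃ ε : ℂ, ε ^ 2 = 1 ∧ ∀ τ, root τ = ε * sqrtFactor mat τ

namespace DoubleCover

theorem continuous_root (x : DoubleCover) : Continuous x.root := by
  obtain ⟨ε, -, h⟩ := x.exists_sign
  rw [funext h]
  exact continuous_const.mul (continuous_sqrtFactor _)

theorem root_sq (x : DoubleCover) (τ : UpperHalfPlane) : x.root τ ^ 2 = autFactor x.mat τ := by
  obtain ⟨ε, hε, h⟩ := x.exists_sign
  rw [h, mul_pow, hε, one_mul, sqrtFactor_sq]

theorem root_ne_zero (x : DoubleCover) (τ : UpperHalfPlane) : x.root τ ≠ 0 := by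
  intro h
  apply autFactor_ne_zero x.mat τ
  rw [← root_sq, h]
  simp

/-- `(γ₁, φ₁(τ)) (γ₂, φ₂(τ)) = (γ₁ γ₂, φ₁(γ₂ τ) φ₂(τ))`. -/
instance : Mul DoubleCover where
  mul x y :=
    { mat := x.mat * y.mat
      root := fun τ => x.root (y.mat • τ) * y.root τ
      exists_sign := by
        refine eq_sign_mul_sqrtFactor _ _ ?_ fun τ => ?_
        · exact (x.continuous_root.comp (continuous_smul_SL y.mat)).mul y.continuous_root
        · rw [mul_pow, root_sq, root_sq, autFactor_mul] }

instance : One DoubleCover where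
  one :=
    { mat := 1
      root := fun _ => 1
      exists_sign := ⟨1, by simp, fun τ => by simp [sqrtFactor, autFactor_one]⟩ }

instance : Inv DoubleCover where
  inv x :=
    { mat := x.mat⁻¹
      root := fun τ => (x.root (x.mat⁻¹ • τ))⁻¹
      exists_sign := by
        refine eq_sign_mul_sqrtFactor _ _ ?_ fun τ => ?_
        · exact (x.continuous_root.comp (continuous_smul_SL x.mat⁻¹)).inv₀
            fun τ => x.root_ne_zero _
        · have h := autFactor_mul x.mat x.mat⁻¹ τ
          rw [mul_inv_cancel, autFactor_one] at h
          rw [inv_pow, root_sq]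
          exact inv_eq_of_mul_eq_one_right h.symm }

theorem mat_mul (x y : DoubleCover) : (x * y).mat = x.mat * y.mat := rfl

theorem root_mul (x y : DoubleCover) (τ : UpperHalfPlane) :
    (x * y).root τ = x.root (y.mat • τ) * y.root τ := rfl

theorem mat_one : (1 : DoubleCover).mat = 1 := rfl

theorem root_one (τ : UpperHalfPlane) : (1 : DoubleCover).root τ = 1 := rfl

theorem mat_inv (x : DoubleCover) : (x⁻¹).mat = x.mat⁻¹ := rfl

theorem root_inv (x : DoubleCover) (τ : UpperHalfPlane) :
    (x⁻¹).root τ = (x.root (x.mat⁻¹ • τ))⁻¹ := rfl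

instance : Group DoubleCover :=
  Group.ofLeftAxioms
    (fun x y z => by
      ext τ
      · simp [mat_mul, mul_assoc]
      · simp [root_mul, mat_mul, mul_smul, mul_assoc])
    (fun x => by
      ext τ
      · simp [mat_mul, mat_one]
      · simp [root_mul, root_one])
    (fun x => by
      ext τ
      · simp [mat_mul, mat_inv, mat_one]
      · simp [root_mul, root_inv, root_one, x.root_ne_zero])

/-- The projection to `SL(2, ℤ)`. -/
def proj : DoubleCover →* SL(2, ℤ) where
  toFun := mat
  map_one' := rfl
  map_mul' _ _ := rfl

end DoubleCover

/-- The preimage of `Γ₀(N)` in the double cover. -/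
def Gamma0Cover (N : ℕ) : Subgroup DoubleCover :=
  (CongruenceSubgroup.Gamma0 N).comap DoubleCover.proj

/-! ### Eta-quotients and their characters

A weight `k ∈ (1/2) ℤ` is recorded by the integer `m = 2 k`. -/

/-- Integral vectors `(r_n)` indexed by the positive divisors `n` of `N`. -/
abbrev Exponents (N : ℕ) : Type := N.divisors → ℤ

/-- The standard basis vector `e_n`, for `n ∣ N`. -/
def basisVec (N n : ℕ) : Exponents N := fun d => if (d : ℕ) = n then 1 else 0

/-- The eta-quotient `∏_{n ∣ N} η(n τ) ^ {r_n}`. -/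
def etaQuotient {N : ℕ} (r : Exponents N) (τ : UpperHalfPlane) : ℂ :=
  ∏ n : N.divisors, ModularForm.eta (((n : ℕ) : ℂ) * (τ : ℂ)) ^ (r n)

/-- The slash operator of weight `k = m / 2`:
`(f ∣_k (γ, φ))(τ) = φ(τ) ^ (-2 k) f(γ τ)`. -/
def slash (m : ℤ) (f : UpperHalfPlane → ℂ) (x : DoubleCover) (τ : UpperHalfPlane) : ℂ :=
  x.root τ ^ (-m) * f (x.mat • τ)

/-- `χ` is the character of the eta-quotient with exponent vector `r`, whose weight is
`(1/2) ∑ r_n`. -/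
def IsCharacterOf {N : ℕ} (χ : Gamma0Cover N →* Circle) (r : Exponents N) : Prop :=
  ∀ (x : Gamma0Cover N) (τ : UpperHalfPlane),
    slash (∑ n, r n) (etaQuotient r) x τ = (χ x : ℂ) * etaQuotient r τ

/-- `S(N, k)` with `m = 2 k`: the exponent vectors of eta-quotients of weight `k`. -/
def weightSet (N : ℕ) (m : ℤ) : Set (Exponents N) := {r | ∑ n, r n = m}

/-- The characters of the eta-quotients of level `N`, weight `k = m / 2` and integral exponents. -/
def etaCharacters (N : ℕ) (m : ℤ) : Set (Gamma0Cover N →* Circle) :=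
  {χ | ∃ r ∈ weightSet N m, IsCharacterOf χ r}

/-! ### The groups `S(N)`, `Z(N)` and their quotient -/

/-- `S(N) = S(N, 0)` as a group. -/
def S (N : ℕ) : AddSubgroup (Exponents N) where
  carrier := weightSet N 0
  zero_mem' := by simp [weightSet]
  add_mem' := by
    intro a b ha hb
    change ∑ n, (a n + b n) = 0
    rw [Finset.sum_add_distrib, show ∑ n, a n = 0 from ha, show ∑ n, b n = 0 from hb, add_zero]
  neg_mem' := by
    intro a ha
    change ∑ n, -a n = 0
    rw [Finset.sum_neg_distrib, show ∑ n, a n = 0 from ha, neg_zero]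

/-- The product of the divisors `n` of `N` with `r_n` odd. -/
def oddPart {N : ℕ} (r : Exponents N) : ℕ := ∏ n : N.divisors with Odd (r n), (n : ℕ)

theorem isSquare_oddPart_add {N : ℕ} (a b : Exponents N) (ha : IsSquare (oddPart a))
    (hb : IsSquare (oddPart b)) : IsSquare (oddPart (a + b)) := by
  have key : oddPart (a + b) * (∏ n : N.divisors with Odd (a n) ∧ Odd (b n), (n : ℕ)) ^ 2
      = oddPart a * oddPart b := by
    simp only [oddPart, Finset.prod_filter, ← Finset.prod_pow, ← Finset.prod_mul_distrib]
    refine Finset.prod_congr rfl fun n _ => ?_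
    by_cases h1 : Odd (a n) <;> by_cases h2 : Odd (b n) <;> simp [Int.odd_add, h1, h2, sq]
  have hne : (∏ n : N.divisors with Odd (a n) ∧ Odd (b n), (n : ℕ)) ≠ 0 :=
    Finset.prod_ne_zero_iff.mpr fun n _ => (Nat.pos_of_mem_divisors n.2).ne'
  obtain ⟨y, hy⟩ := ha.mul hb
  rw [hy, ← sq] at key
  obtain ⟨z, hz⟩ := (Nat.pow_dvd_pow_iff two_ne_zero).mp (Dvd.intro_left _ key)
  refine ⟨z, ?_⟩
  rw [hz, mul_pow, mul_comm] at key
  rw [← sq]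
  exact Nat.eq_of_mul_eq_mul_left (Nat.pos_of_ne_zero (pow_ne_zero 2 hne)) key

/-- `Z(N)`: the vectors of `S(N)` with `∑ n r_n ≡ 0` and `∑ (N / n) r_n ≡ 0` modulo `24` for which
the product of the `n` with `r_n` odd is a perfect square. -/
def Z (N : ℕ) : AddSubgroup (Exponents N) where
  carrier := {r | ∑ n, r n = 0 ∧ (24 : ℤ) ∣ ∑ n : N.divisors, ((n : ℕ) : ℤ) * r n ∧
    (24 : ℤ) ∣ ∑ n : N.divisors, ((N / (n : ℕ) : ℕ) : ℤ) * r n ∧ IsSquare (oddPart r)}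
  zero_mem' := by simp [oddPart]
  add_mem' := by
    rintro a b ⟨h1, h2, h3, h4⟩ ⟨k1, k2, k3, k4⟩
    refine ⟨?_, ?_, ?_, isSquare_oddPart_add a b h4 k4⟩
    · exact (S N).add_mem h1 k1
    · simpa [mul_add, Finset.sum_add_distrib] using dvd_add h2 k2
    · simpa [mul_add, Finset.sum_add_distrib] using dvd_add h3 k3
  neg_mem' := by
    rintro a ⟨h1, h2, h3, h4⟩
    refine ⟨?_, ?_, ?_, ?_⟩
    · exact (S N).neg_mem h1
    · simpa using h2
    · simpa using h3
    · simpa [oddPart] using h4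

/-- The quotient group `S(N) / Z(N)`. -/
abbrev CharQuotient (N : ℕ) : Type := S N ⧸ (Z N).addSubgroupOf (S N)

/-! ### The index set, the numbers `Δ_i` and the representatives -/

/-- The part of the index set at a prime divisor `p` of `N`. -/
def indexSetAt (N p : ℕ) : Finset ℕ :=
  if p = 2 then
    if N.factorization 2 = 1 then {2}
    else if N.factorization 2 = 2 then {2, 4}
    else {2 ^ (N.factorization 2 - 2), 2 ^ (N.factorization 2 - 1), 2 ^ N.factorization 2}
  else if p = 3 then
    if N.factorization 3 = 1 then {3}
    else {3 ^ (N.factorization 3 - 1), 3 ^ N.factorization 3}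
  else {p}

/-- The index set: the union of its parts over the primes dividing `N`. -/
def indexSet (N : ℕ) : Finset ℕ := N.primeFactors.biUnion (indexSetAt N)

/-- The system of congruences on `(c_n)`, `n` in the index set (values of `c` elsewhere play no
role). -/
def CongruenceSystem (N : ℕ) (c : ℕ → ℤ) : Prop :=
  (24 : ℤ) ∣ ∑ n ∈ indexSet N, ((n : ℤ) - 1) * c n ∧
  (24 : ℤ) ∣ ∑ n ∈ indexSet N, (((N / n : ℕ) : ℤ) - (N : ℤ)) * c n ∧
  (∀ p ∈ N.primeFactors, p ≠ 2 → p ≠ 3 → Even (c p)) ∧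
  Even (∑ β ∈ Finset.range (N.factorization 2 + 1) with
    2 ^ β ∈ indexSet N ∧ Odd (c (2 ^ β)), β) ∧
  Even (∑ β ∈ Finset.range (N.factorization 3 + 1) with
    3 ^ β ∈ indexSet N ∧ Odd (c (3 ^ β)), β)

/-- The number `Δ_i` attached to an ordering `b` of the index set: the least `1 ≤ m ≤ 24` for which
the system has a solution with `c_{b_j} = 0` for `j < i` and `c_{b_i} = m`. -/
def Delta {N t : ℕ} (b : Fin t ≃ indexSet N) (i : Fin t) : ℕ :=
  sInf {m : ℕ | 1 ≤ m ∧ m ≤ 24 ∧ ∃ c : ℕ → ℤ, CongruenceSystem N c ∧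
    (∀ j < i, c (b j) = 0) ∧ c (b i) = m}

/-- The vectors `∑_j c_j e_{b_j} + (m - ∑_j c_j) e_1` with `0 ≤ c_j < Δ_j`. -/
def representatives {N t : ℕ} (b : Fin t ≃ indexSet N) (m : ℤ) : Set (Exponents N) :=
  {v | ∃ c : Fin t → ℤ, (∀ j, 0 ≤ c j ∧ c j < Delta b j) ∧
    v = ∑ j, c j • basisVec N (b j) + (m - ∑ j, c j) • basisVec N 1}

end EtaChar

end

noncomputable section

namespace EtaChar

/-! ### The multiplier system of the eta function -/

/-! The η-function transforms under the double cover of SL₂(ℤ) with a unitary multiplier, and η(nτ)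
transforms under γ ∈ Γ₀(N) with the multiplier of the conjugate (a, nb; c/n, d). Hence every
eta-quotient has a character `etaChar r`, unique because η has no zeros. Two vectors of equal weight
share it iff their difference, of weight 0, has trivial character. Two facts remain.

The kernel in weight 0 is Z(N) (`etaChar_eq_one_iff`). There the signs of the roots cancel, so the
character depends on the matrix alone. With ζ = exp(2πi/24), it is ζ^{Σ n r_n} on T and ζ^{-Σ (N/n)
r_n} on the lower unipotent matrix with entry N. If 24N ∣ c, 24 ∣ b and d > 0, it is the Jacobi
symbol of `oddPart r` over d. Unipotent factors bring every matrix of Γ₀(N) to this last shape,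
because d² ≡ 1 mod 24 for d prime to 6, and a non-square has symbol -1 over some admissible d. The
Jacobi symbol comes from the closed multiplier formula (`etaMultFormula_of_even`), proved by
Euclidean descent on d with quadratic reciprocity accounting for the signs.

The index set spans modulo Z(N). The class of e_n - e_1 is recorded by `invVec N n`, and (*) says
that Σ c_n `invVec N n` = 0. The complementary idempotents 9 and 16 of ℤ/24 separate the parts
modulo 8 and 3, where short relations express every divisor through the index set (`invVec_mem`).
The Δ_i are the pivots of a triangular basis of the relation lattice, so division with remainder
gives unique representatives (`existsUnique_reduced`). Since e_1 has invariant 0, the weight plays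
no role. In level 2^α, α ≥ 3, the first invariant is free, the second is determined modulo 3 and
free modulo 8, and one parity is free: 24 · 8 · 2 = 384. -/

open UpperHalfPlane in
theorem eta_ne_zero (τ : ℍ) : ModularForm.eta (τ : ℂ) ≠ 0 := ModularForm.eta_ne_zero τ.2

/-- The root of unity `exp (2 π i / 24)`. -/
def zeta : Circle := Circle.exp (2 * Real.pi / 24)

theorem zeta_zpow_eq_one_iff (k : ℤ) : zeta ^ k = 1 ↔ (24 : ℤ) ∣ k := by
  rw [zeta, ← Circle.exp_zsmul, Circle.exp_eq_one]
  have := Real.pi_pos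
  constructor
  · rintro ⟨m, hm⟩
    refine ⟨m, ?_⟩
    rw [zsmul_eq_mul] at hm
    field_simp at hm
    exact_mod_cast hm
  · rintro ⟨m, rfl⟩
    refine ⟨m, ?_⟩
    push_cast [zsmul_eq_mul]
    ring

theorem zeta_zpow_congr {k l : ℤ} (h : (24 : ℤ) ∣ k - l) : zeta ^ k = zeta ^ l := by
  rw [← sub_add_cancel k l, zpow_add, (zeta_zpow_eq_one_iff _).mpr h, one_mul]

theorem coe_zeta_zpow_twelve : ((zeta ^ (12 : ℤ) : Circle) : ℂ) = -1 := by
  rw [zeta, ← Circle.exp_zsmul, Circle.coe_exp, zsmul_eq_mul,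
    show ((((12 : ℤ) : ℝ) * (2 * Real.pi / 24) : ℝ) : ℂ) = Real.pi by push_cast; ring]
  exact Complex.exp_pi_mul_I

/-- The principal lift of a matrix to the double cover. -/
def lift (γ : SL(2, ℤ)) : DoubleCover where
  mat := γ
  root := sqrtFactor γ
  exists_sign := ⟨1, by simp, fun τ => by simp⟩

theorem mat_lift (γ : SL(2, ℤ)) : (lift γ).mat = γ := rfl
theorem root_lift (γ : SL(2, ℤ)) (τ : UpperHalfPlane) : (lift γ).root τ = sqrtFactor γ τ := rfl

theorem eta_T_smul (τ : UpperHalfPlane) :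
    ModularForm.eta ((ModularGroup.T • τ : UpperHalfPlane) : ℂ)
      = zeta * ModularForm.eta (τ : ℂ) := by
  have h1 : ((ModularGroup.T • τ : UpperHalfPlane) : ℂ) = (τ : ℂ) + 1 := by
    rw [UpperHalfPlane.modular_T_smul, UpperHalfPlane.coe_vadd]; push_cast; ring
  have h2 : ∀ n, ModularForm.eta_q n ((τ : ℂ) + 1) = ModularForm.eta_q n (τ : ℂ) := by
    intro n
    simp only [ModularForm.eta_q, Function.Periodic.qParam]
    congr 1
    rw [← Complex.exp_periodic (2 * Real.pi * Complex.I * τ / (1 : ℝ))]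
    congr 1
    push_cast
    ring
  rw [h1]
  unfold ModularForm.eta
  simp only [h2]
  rw [← mul_assoc]
  congr 1
  rw [zeta, Circle.coe_exp, Function.Periodic.qParam, Function.Periodic.qParam, ← Complex.exp_add]
  congr 1
  push_cast
  ring

theorem norm_sqrt_I_inv : ‖(Complex.sqrt Complex.I)⁻¹‖ = 1 := by
  have h : Complex.sqrt Complex.I ^ 2 = Complex.I := by
    rw [Complex.sqrt, ← Complex.cpow_nat_mul]; simp
  have : ‖Complex.sqrt Complex.I‖ ^ 2 = 1 := by rw [← norm_pow, h, Complex.norm_I]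
  rw [norm_inv, (pow_eq_one_iff_of_nonneg (norm_nonneg _) (by norm_num)).mp this, inv_one]

theorem eta_S_smul (τ : UpperHalfPlane) :
    ModularForm.eta ((ModularGroup.S • τ : UpperHalfPlane) : ℂ)
      = (Complex.sqrt Complex.I)⁻¹ * (sqrtFactor ModularGroup.S τ * ModularForm.eta (τ : ℂ)) := by
  have h := ModularForm.eta_comp_eq_csqrt_I_inv τ.2
  rw [UpperHalfPlane.modular_S_smul, UpperHalfPlane.coe_mk]
  simp only [Function.comp_apply, Pi.smul_apply, Pi.mul_apply, smul_eq_mul] at h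
  rw [neg_div, one_div, ← inv_neg] at h
  rw [h]
  simp [sqrtFactor, autFactor, ModularGroup.S, Complex.sqrt]

/-- The elements of the double cover under which `η` is invariant up to a unitary constant. -/
def etaStabilizer : Subgroup DoubleCover where
  carrier := {x | ∃ v : Circle, ∀ τ : UpperHalfPlane,
    ModularForm.eta ((x.mat • τ : UpperHalfPlane) : ℂ) = v * x.root τ * ModularForm.eta (τ : ℂ)}
  one_mem' := ⟨1, fun τ => by simp [DoubleCover.mat_one, DoubleCover.root_one]⟩
  mul_mem' := by
    rintro x y ⟨v, hv⟩ ⟨w, hw⟩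
    refine ⟨v * w, fun τ => ?_⟩
    rw [DoubleCover.mat_mul, DoubleCover.root_mul, mul_smul, hv, hw]
    push_cast; ring
  inv_mem' := by
    rintro x ⟨v, hv⟩
    refine ⟨v⁻¹, fun τ => ?_⟩
    have h := hv (x.mat⁻¹ • τ)
    rw [smul_inv_smul] at h
    rw [DoubleCover.mat_inv, DoubleCover.root_inv, h]
    have := x.root_ne_zero (x.mat⁻¹ • τ)
    have := v.coe_ne_zero
    push_cast
    field_simp

theorem exists_sign_of_mat_eq {x y : DoubleCover} (h : x.mat = y.mat) :
    ∃ ε : ℂ, ε ^ 2 = 1 ∧ ∀ τ, x.root τ = ε * y.root τ := by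
  obtain ⟨ε, hε, hx⟩ := x.exists_sign
  obtain ⟨δ, hδ, hy⟩ := y.exists_sign
  refine ⟨ε * δ, by rw [mul_pow, hε, hδ, one_mul], fun τ => ?_⟩
  rw [hx, hy, h]
  linear_combination (-ε * sqrtFactor y.mat τ) * hδ

theorem mem_etaStabilizer (x : DoubleCover) : x ∈ etaStabilizer := by
  -- The projection contains the generators S and T, hence is everything. Any `x` then differs from
  -- a stabilizing element only by the sign of its root, which the unitary constant absorbs.
  have htop : etaStabilizer.map DoubleCover.proj = ⊤ := by
    rw [eq_top_iff, ← SpecialLinearGroup.SL2Z_generators, Subgroup.closure_le]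
    rintro γ (rfl | rfl)
    · refine ⟨lift ModularGroup.S, ⟨⟨(Complex.sqrt Complex.I)⁻¹, ?_⟩, fun τ => ?_⟩, rfl⟩
      · simpa [Submonoid.unitSphere] using norm_sqrt_I_inv
      · rw [mat_lift, eta_S_smul, root_lift, mul_assoc]
    · refine ⟨lift ModularGroup.T, ⟨zeta, fun τ => ?_⟩, rfl⟩
      rw [mat_lift, eta_T_smul, root_lift]
      simp [sqrtFactor, autFactor, ModularGroup.T]
  obtain ⟨y, ⟨v, hv⟩, hy⟩ : x.mat ∈ etaStabilizer.map DoubleCover.proj := htop ▸ Subgroup.mem_top _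
  change y.mat = x.mat at hy
  obtain ⟨ε, hε, h⟩ := exists_sign_of_mat_eq hy
  have hnorm : ‖ε‖ ^ 2 = 1 := by rw [← norm_pow, hε, norm_one]
  have hmem : ε ∈ Submonoid.unitSphere ℂ := by
    simpa [Submonoid.unitSphere] using
      (pow_eq_one_iff_of_nonneg (norm_nonneg _) (by norm_num)).mp hnorm
  obtain ⟨δ, hδ⟩ : ∃ δ : Circle, (δ : ℂ) = ε := ⟨⟨ε, hmem⟩, rfl⟩
  refine ⟨δ * v, fun τ => ?_⟩
  rw [← hy, hv, h, ← hδ]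
  push_cast
  ring

/-- The multiplier system of the Dedekind eta function, a character of the double cover. -/
def etaMult : DoubleCover →* Circle :=
  MonoidHom.mk' (fun x => (mem_etaStabilizer x).choose) fun x y => by
    have hx := (mem_etaStabilizer x).choose_spec
    have hy := (mem_etaStabilizer y).choose_spec
    -- One point determines the constants, since neither η nor the roots vanish; the cocycle rule
    -- for the roots makes them multiplicative.
    have hxy := (mem_etaStabilizer (x * y)).choose_spec UpperHalfPlane.I
    rw [show (x * y).mat • UpperHalfPlane.I = x.mat • y.mat • UpperHalfPlane.I from mul_smul _ _ _,
      DoubleCover.root_mul, hx, hy] at hxy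
    have h1 := x.root_ne_zero (y.mat • UpperHalfPlane.I)
    have h2 := y.root_ne_zero UpperHalfPlane.I
    have h3 := eta_ne_zero UpperHalfPlane.I
    ext
    push_cast
    apply mul_right_cancel₀ (mul_ne_zero (mul_ne_zero h1 h2) h3)
    linear_combination -hxy

theorem eta_smul (x : DoubleCover) (τ : UpperHalfPlane) :
    ModularForm.eta ((x.mat • τ : UpperHalfPlane) : ℂ)
      = etaMult x * x.root τ * ModularForm.eta (τ : ℂ) :=
  (mem_etaStabilizer x).choose_spec τ

theorem etaMult_eq_of_eta_smul {x : DoubleCover} {v : ℂ} {τ : UpperHalfPlane}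
    (h : ModularForm.eta ((x.mat • τ : UpperHalfPlane) : ℂ)
      = v * x.root τ * ModularForm.eta (τ : ℂ)) : (etaMult x : ℂ) = v := by
  rw [eta_smul] at h
  exact mul_right_cancel₀ (x.root_ne_zero τ) (mul_right_cancel₀ (eta_ne_zero τ) h)

theorem etaMult_of_mat_eq {x y : DoubleCover} {ε : ℂ} (hε : ε ^ 2 = 1) (h : x.mat = y.mat)
    (hr : ∀ τ, x.root τ = ε * y.root τ) : (etaMult x : ℂ) = ε * etaMult y := by
  refine etaMult_eq_of_eta_smul (τ := UpperHalfPlane.I) ?_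
  rw [h, eta_smul, hr]
  linear_combination (-(etaMult y : ℂ) * y.root UpperHalfPlane.I
    * ModularForm.eta (UpperHalfPlane.I : ℂ)) * hε

theorem etaMult_lift_T : etaMult (lift ModularGroup.T) = zeta := by
  ext
  refine etaMult_eq_of_eta_smul (τ := UpperHalfPlane.I) ?_
  rw [mat_lift, eta_T_smul, root_lift]
  simp [sqrtFactor, autFactor, ModularGroup.T]

end EtaChar

end

noncomputable section

namespace EtaChar

/-! ### Principal lifts of products -/
open ModularGroup Filter Topology

theorem autFactor_T_zpow (k : ℤ) (τ : UpperHalfPlane) : autFactor (T ^ k) τ = 1 := by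
  simp [autFactor, coe_T_zpow]

/-- In general the principal lift is multiplicative only up to sign. Powers of `T` cause no sign
because their automorphy factor is 1. -/
theorem lift_mul_T_zpow (γ : SL(2, ℤ)) (k : ℤ) : lift (γ * T ^ k) = lift γ * lift (T ^ k) := by
  ext τ
  · rfl
  · rw [DoubleCover.root_mul, mat_lift, root_lift, root_lift, root_lift, sqrtFactor, sqrtFactor,
      sqrtFactor, autFactor_mul, autFactor_T_zpow]
    simp

theorem lift_T_zpow_mul (γ : SL(2, ℤ)) (k : ℤ) : lift (T ^ k * γ) = lift (T ^ k) * lift γ := by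
  ext τ
  · rfl
  · rw [DoubleCover.root_mul, mat_lift, root_lift, root_lift, root_lift, sqrtFactor, sqrtFactor,
      sqrtFactor, autFactor_mul, autFactor_T_zpow]
    simp

theorem lift_one : lift 1 = 1 := by
  ext τ
  · rfl
  · simp [root_lift, sqrtFactor, autFactor_one, DoubleCover.root_one]

theorem etaMult_lift_T_zpow (k : ℤ) : etaMult (lift (T ^ k)) = zeta ^ k := by
  have h : ∀ k : ℤ, etaMult (lift (T ^ (k + 1))) = etaMult (lift (T ^ k)) * zeta := fun k => by
    rw [← etaMult_lift_T, ← map_mul, zpow_add, lift_mul_T_zpow, zpow_one]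
  induction k using Int.induction_on with
  | zero => simp [lift_one]
  | succ i ih => rw [h, ih, zpow_add_one]
  | pred i ih =>
    have h' := h (-(i : ℤ) - 1)
    rw [sub_add_cancel, ih] at h'
    rw [zpow_sub_one zeta, h', mul_inv_cancel_right]

/-- The lower unipotent matrix with lower left entry `k`. -/
def lowerUnipotent (k : ℤ) : SL(2, ℤ) := ⟨!![1, 0; k, 1], by simp [Matrix.det_fin_two]⟩

theorem coe_lowerUnipotent (k : ℤ) :
    (lowerUnipotent k : Matrix (Fin 2) (Fin 2) ℤ) = !![1, 0; k, 1] := rfl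

theorem cpow_half_re_nonneg (z : ℂ) : 0 ≤ (z ^ (1 / 2 : ℂ)).re := by
  rcases eq_or_ne z 0 with rfl | hz
  · simp
  rw [Complex.cpow_def_of_ne_zero hz, Complex.exp_re]
  refine mul_nonneg (Real.exp_pos _).le (Real.cos_nonneg_of_neg_pi_div_two_le_of_le ?_ ?_)
  all_goals
    have h1 := Complex.neg_pi_lt_arg z
    have h2 := Complex.arg_le_pi z
    simp [Complex.mul_im, Complex.log_im]
    linarith

theorem cpow_half_pos {z : ℂ} (hz : 0 < z.im) :
    0 < (z ^ (1 / 2 : ℂ)).re ∧ 0 < (z ^ (1 / 2 : ℂ)).im := by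
  have hz0 : z ≠ 0 := by rintro rfl; simp at hz
  have h1 : 0 < Complex.arg z := by
    refine lt_of_le_of_ne (Complex.arg_nonneg_iff.mpr hz.le) fun h => ?_
    exact hz.ne' (Complex.arg_eq_zero_iff.mp h.symm).2
  have h2 : Complex.arg z < Real.pi := by
    refine lt_of_le_of_ne (Complex.arg_le_pi z) fun h => ?_
    exact hz.ne' (Complex.arg_eq_pi_iff.mp h).2
  have him : (Complex.log z * (1 / 2)).im = Complex.arg z / 2 := by
    simp [Complex.mul_im, Complex.log_im]
    ring
  rw [Complex.cpow_def_of_ne_zero hz0, Complex.exp_re, Complex.exp_im, him]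
  exact ⟨mul_pos (Real.exp_pos _) (Real.cos_pos_of_mem_Ioo ⟨by linarith, by linarith⟩),
    mul_pos (Real.exp_pos _) (Real.sin_pos_of_pos_of_lt_pi (by linarith) (by linarith))⟩

/-- The matrices agree, so only a sign is in doubt. At i the root of the product is a quotient of
square roots of two points of the upper half plane. Both roots lie in the open first quadrant, so
the quotient has positive real part, while the principal root has nonnegative real part: the sign is
not -1. -/
theorem lift_lowerUnipotent (k : ℤ) :
    lift (lowerUnipotent k) = lift ModularGroup.S * lift (T ^ (-k)) * (lift ModularGroup.S)⁻¹ := by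
  set y := lift ModularGroup.S * lift (T ^ (-k)) * (lift ModularGroup.S)⁻¹ with hy
  have hmat : y.mat = lowerUnipotent k := by
    change ModularGroup.S * T ^ (-k) * ModularGroup.S⁻¹ = lowerUnipotent k
    rw [mul_inv_eq_iff_eq_mul]
    apply Subtype.ext
    simp only [Matrix.SpecialLinearGroup.coe_mul, coe_T_zpow, ModularGroup.coe_S,
      coe_lowerUnipotent, Matrix.mul_fin_two]
    norm_num
  obtain ⟨ε, hε, h⟩ := exists_sign_of_mat_eq (y := lift (lowerUnipotent k)) hmat
  suffices hε1 : ε = 1 by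
    refine DoubleCover.ext hmat.symm (funext fun τ => ?_)
    rw [h, hε1, one_mul]
  rcases sq_eq_one_iff.mp hε with h1 | h1
  · exact h1
  exfalso
  set w : UpperHalfPlane := ModularGroup.S⁻¹ • UpperHalfPlane.I
  have hroot : y.root UpperHalfPlane.I
      = ((w : ℂ) - k) ^ (1 / 2 : ℂ) / (w : ℂ) ^ (1 / 2 : ℂ) := by
    rw [hy, DoubleCover.root_mul, DoubleCover.root_mul, DoubleCover.root_inv, DoubleCover.mat_inv]
    simp only [mat_lift, root_lift, sqrtFactor, autFactor_T_zpow]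
    have h2 : ((T ^ (-k) • w : UpperHalfPlane) : ℂ) = w - k := by
      rw [ModularGroup.coe_T_zpow_smul_eq]; push_cast; ring
    have h3 : ∀ z : UpperHalfPlane, autFactor ModularGroup.S z = z := fun z => by
      simp [autFactor, ModularGroup.S]
    change autFactor ModularGroup.S (T ^ (-k) • w) ^ (1 / 2 : ℂ) * _ *
      (autFactor ModularGroup.S w ^ (1 / 2 : ℂ))⁻¹ = _
    rw [h3, h3, h2]
    simp [div_eq_mul_inv]
  have hw : 0 < (w : ℂ).im := w.im_pos
  obtain ⟨hp1, hp2⟩ := cpow_half_pos (z := (w : ℂ) - k) (by simpa using hw)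
  obtain ⟨hq1, hq2⟩ := cpow_half_pos hw
  have hpos : 0 < (y.root UpperHalfPlane.I).re := by
    rw [hroot, Complex.div_re]
    have : 0 < Complex.normSq ((w : ℂ) ^ (1 / 2 : ℂ)) :=
      Complex.normSq_pos.mpr fun h0 => by rw [h0] at hq1; simp at hq1
    positivity
  have hneg := cpow_half_re_nonneg (autFactor (lowerUnipotent k) UpperHalfPlane.I)
  rw [h, h1, root_lift, sqrtFactor] at hpos
  simp only [neg_mul, one_mul, Complex.neg_re] at hpos
  linarith

theorem etaMult_lift_lowerUnipotent (k : ℤ) : etaMult (lift (lowerUnipotent k)) = zeta ^ (-k) := by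
  rw [lift_lowerUnipotent, map_mul, map_mul, map_inv, etaMult_lift_T_zpow]
  rw [mul_comm, inv_mul_cancel_left]

/-- The filter of neighbourhoods of the cusp `0` in the upper half plane. -/
def nhdsCuspZero : Filter UpperHalfPlane := comap UpperHalfPlane.coe (𝓝 0)

instance : NeBot nhdsCuspZero := by
  rw [nhdsCuspZero, comap_neBot_iff]
  intro t ht
  obtain ⟨ε, hε, hball⟩ := Metric.mem_nhds_iff.mp ht
  refine ⟨⟨(ε / 2 : ℝ) * Complex.I, by simpa using hε⟩, hball ?_⟩
  simp [abs_of_pos hε]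
  linarith

theorem tendsto_coe_nhdsCuspZero : Tendsto UpperHalfPlane.coe nhdsCuspZero (𝓝 0) := tendsto_comap

theorem tendsto_sqrtFactor {γ : SL(2, ℤ)} (hd : 0 < γ 1 1) :
    Tendsto (sqrtFactor γ) nhdsCuspZero (𝓝 ((((γ 1 1 : ℤ) : ℝ) : ℂ) ^ (1 / 2 : ℂ))) := by
  have h1 : Tendsto (autFactor γ) nhdsCuspZero (𝓝 (((γ 1 1 : ℤ) : ℝ) : ℂ)) := by
    have := (tendsto_coe_nhdsCuspZero.const_mul ((γ 1 0 : ℤ) : ℂ)).add_const ((γ 1 1 : ℤ) : ℂ)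
    rw [mul_zero, zero_add] at this
    rw [Complex.ofReal_intCast]
    exact this
  refine h1.cpow tendsto_const_nhds (Or.inl ?_)
  simpa using hd

theorem tendsto_smul_nhdsCuspZero {γ : SL(2, ℤ)} (hb : γ 0 1 = 0) (hd : 0 < γ 1 1) :
    Tendsto (fun τ => γ • τ) nhdsCuspZero nhdsCuspZero := by
  rw [nhdsCuspZero, tendsto_comap_iff, ← nhdsCuspZero]
  have h1 := tendsto_coe_nhdsCuspZero.const_mul ((γ 0 0 : ℤ) : ℂ)
  have h2 := (tendsto_coe_nhdsCuspZero.const_mul ((γ 1 0 : ℤ) : ℂ)).add_const ((γ 1 1 : ℤ) : ℂ)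
  have h3 := h1.div h2 (by simpa using hd.ne')
  rw [mul_zero, zero_div] at h3
  refine h3.congr fun τ => ?_
  rw [Function.comp_apply, UpperHalfPlane.coe_specialLinearGroup_apply]
  simp [hb]

/-- As τ → 0 also δτ → 0, because the upper right entry of δ is 0. The roots tend to the positive
square roots of the lower right entries, which multiply, so the sign is 1. -/
theorem lift_mul_of_lower {γ δ : SL(2, ℤ)} (hγ : 0 < γ 1 1) (hb : δ 0 1 = 0) (hδ : 0 < δ 1 1) :
    lift (γ * δ) = lift γ * lift δ := by
  obtain ⟨ε, -, h⟩ := exists_sign_of_mat_eq (x := lift γ * lift δ) (y := lift (γ * δ)) rfl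
  have hd : (γ * δ) 1 1 = γ 1 1 * δ 1 1 := by
    simp [Matrix.mul_apply, Fin.sum_univ_two, hb]
  suffices hε1 : ε = 1 by
    ext τ
    · rfl
    · rw [h, hε1, one_mul]
  have h1 := ((tendsto_sqrtFactor hγ).comp (tendsto_smul_nhdsCuspZero hb hδ)).mul
    (tendsto_sqrtFactor hδ)
  have hγδ : 0 < (γ * δ) 1 1 := hd ▸ mul_pos hγ hδ
  have h2 := (tendsto_sqrtFactor hγδ).const_mul ε
  have h3 := tendsto_nhds_unique (h1.congr h) h2
  rw [hd, Int.cast_mul, Complex.ofReal_mul, Complex.mul_cpow_ofReal_nonneg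
    (by exact_mod_cast hγ.le) (by exact_mod_cast hδ.le)] at h3
  refine (mul_right_cancel₀ (mul_ne_zero ?_ ?_) ((one_mul _).trans h3)).symm
  · simp [hγ.ne']
  · simp [hδ.ne']

end EtaChar

end

noncomputable section

namespace EtaChar

/-! ### The closed formula for the eta multiplier -/
open ModularGroup

/-- The exponent of `zeta` in the formula for the eta multiplier. -/
def etaExponent (γ : SL(2, ℤ)) : ℤ :=
  (γ 0 0 + γ 1 1) * γ 1 0 - γ 0 1 * γ 1 1 * (γ 1 0 ^ 2 - 1) + 3 * γ 1 1 - 3 - 3 * γ 1 0 * γ 1 1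

/-- The closed formula for the eta multiplier on the principal lift of `γ`. -/
def EtaMultFormula (γ : SL(2, ℤ)) : Prop :=
  (etaMult (lift γ) : ℂ) =
    (jacobiSym (γ 1 0) (γ 1 1).toNat : ℂ) * ((zeta ^ etaExponent γ : Circle) : ℂ)

theorem det_eq (γ : SL(2, ℤ)) : γ 0 0 * γ 1 1 - γ 0 1 * γ 1 0 = 1 := by
  have := γ.det_coe
  rwa [Matrix.det_fin_two] at this

theorem mul_T_zpow_apply (γ : SL(2, ℤ)) (k : ℤ) :
    (γ * T ^ k) 0 0 = γ 0 0 ∧ (γ * T ^ k) 0 1 = γ 0 0 * k + γ 0 1 ∧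
    (γ * T ^ k) 1 0 = γ 1 0 ∧ (γ * T ^ k) 1 1 = γ 1 0 * k + γ 1 1 := by
  simp [Matrix.SpecialLinearGroup.coe_mul, coe_T_zpow, Matrix.mul_apply, Fin.sum_univ_two]

theorem T_zpow_mul_apply (γ : SL(2, ℤ)) (k : ℤ) :
    (T ^ k * γ) 0 0 = γ 0 0 + k * γ 1 0 ∧ (T ^ k * γ) 0 1 = γ 0 1 + k * γ 1 1 ∧
    (T ^ k * γ) 1 0 = γ 1 0 ∧ (T ^ k * γ) 1 1 = γ 1 1 := by
  simp [Matrix.SpecialLinearGroup.coe_mul, coe_T_zpow, Matrix.mul_apply, Fin.sum_univ_two]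

theorem mul_lowerUnipotent_apply (γ : SL(2, ℤ)) (k : ℤ) :
    (γ * lowerUnipotent k) 0 0 = γ 0 0 + γ 0 1 * k ∧ (γ * lowerUnipotent k) 0 1 = γ 0 1 ∧
    (γ * lowerUnipotent k) 1 0 = γ 1 0 + γ 1 1 * k ∧ (γ * lowerUnipotent k) 1 1 = γ 1 1 := by
  simp [Matrix.SpecialLinearGroup.coe_mul, coe_lowerUnipotent, Matrix.mul_apply, Fin.sum_univ_two]

theorem six_dvd_mul_one_sub_sq (d : ℤ) : 6 ∣ d * (1 - d ^ 2) := by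
  have h : ∀ x : ZMod 6, x * (1 - x ^ 2) = 0 := by decide
  have h' := h d
  exact (ZMod.intCast_zmod_eq_zero_iff_dvd (d * (1 - d ^ (2 : ℕ))) 6).mp (by push_cast; exact h')

theorem jacobiSym_add_mul_right (c d k : ℤ) (hd : 0 < d) :
    jacobiSym (c + d * k) d.toNat = jacobiSym c d.toNat := by
  apply jacobiSym.mod_left'
  rw [Int.toNat_of_nonneg hd.le, Int.add_mul_emod_self_left]

theorem etaMultFormula_of_mul_lowerUnipotent {γ : SL(2, ℤ)} (k : ℤ) (hd : 0 < γ 1 1)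
    (h : EtaMultFormula (γ * lowerUnipotent (2 * k))) : EtaMultFormula γ := by
  obtain ⟨h00, h01, h10, h11⟩ := mul_lowerUnipotent_apply γ (2 * k)
  rw [EtaMultFormula, lift_mul_of_lower hd (by simp [coe_lowerUnipotent])
    (by simp [coe_lowerUnipotent]), map_mul, etaMult_lift_lowerUnipotent, h10, h11,
    jacobiSym_add_mul_right _ _ _ hd] at h
  have he : zeta ^ etaExponent (γ * lowerUnipotent (2 * k))
      = zeta ^ (etaExponent γ + -(2 * k)) := by
    apply zeta_zpow_congr
    rw [etaExponent, etaExponent, h00, h01, h10, h11]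
    -- Up to the determinant relation the discrepancy of the exponents is 4k(a + kb) · d(1 - d²).
    -- The 4 is due to the even shift 2k, and 6 ∣ d(1 - d²) completes 24.
    obtain ⟨m, hm⟩ := six_dvd_mul_one_sub_sq (γ 1 1)
    refine ⟨k * (γ 0 0 + k * γ 0 1) * m, ?_⟩
    linear_combination 4 * k * (γ 0 0 + k * γ 0 1) * hm
      - 4 * k * (1 - γ 1 1 ^ 2) * det_eq γ + 2 * k * det_eq γ
  rw [he, zpow_add, Circle.coe_mul, Circle.coe_mul, ← mul_assoc] at h
  exact mul_right_cancel₀ (Circle.coe_ne_zero _) h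

/-- The defect modulo 8 of the exponent under γ ↦ γT, with c = 2e and a eliminated through the
determinant. The value 4 will produce ζ^12 = -1, in exactly the case where reciprocity changes the
Jacobi symbol. -/
theorem T_step_mod_eight : ∀ e b d : ZMod 8, d * d = 1 →
    6 * e * (1 - 2 * e) - 2 * e * (4 * e ^ 2 - 1) * (d * (1 + 2 * e * b) + 2 * b)
      = if Odd e.val ∧ d.val % 4 = 1 then 4 else 0 := by
  decide

/-- From n' = n + c one has (c/n') = (-n/n') and (n'/n) = (c/n); reciprocity and the value of
(-1/n') combine into the sign. -/
theorem jacobiSym_add_self {c : ℤ} {n n' : ℕ} (hn : Odd n) (hn' : Odd n') (h : (n' : ℤ) = n + c) :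
    jacobiSym c n' = (if n' % 4 = 3 ∧ n % 4 = 1 then -1 else 1) * jacobiSym c n := by
  have h1 : jacobiSym c n' = jacobiSym (-n) n' := by
    apply jacobiSym.mod_left'
    rw [show c = -n + n' by rw [h]; ring, Int.add_emod_right]
  have h2 : jacobiSym n' n = jacobiSym c n := by
    apply jacobiSym.mod_left'
    rw [h, Int.add_emod_left]
  have h3 := jacobiSym.quadratic_reciprocity_if (Nat.odd_iff.mp hn) (Nat.odd_iff.mp hn')
  rw [h1, jacobiSym.neg _ hn', ← h3, h2]
  rcases Nat.odd_mod_four_iff.mp (Nat.odd_iff.mp hn) with a | a <;>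
    rcases Nat.odd_mod_four_iff.mp (Nat.odd_iff.mp hn') with b | b <;>
    first
    | rw [ZMod.χ₄_nat_one_mod_four b]; simp [a, b]
    | rw [ZMod.χ₄_nat_three_mod_four b]; simp [a, b]

theorem zeta_zpow_sign {D : ℤ} (h3 : 3 ∣ D) (p : Prop) [Decidable p]
    (h8 : (D : ZMod 8) = if p then 4 else 0) :
    ((zeta ^ D : Circle) : ℂ) = if p then -1 else 1 := by
  split_ifs at h8 ⊢ with hp
  · have : (8 : ℤ) ∣ D - 4 := (ZMod.intCast_zmod_eq_zero_iff_dvd (D - 4) 8).mp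
      (by push_cast; rw [h8]; rfl)
    rw [zeta_zpow_congr (l := 12) (by omega), coe_zeta_zpow_twelve]
  · have : (8 : ℤ) ∣ D := (ZMod.intCast_zmod_eq_zero_iff_dvd D 8).mp h8
    rw [(zeta_zpow_eq_one_iff D).mpr (by omega), Circle.coe_one]

/-- The multiplier gains a factor ζ. The remaining change of the exponent is divisible by 3, and its
residue modulo 8 is 4 or 0, which matches the change of the Jacobi symbol when d becomes c + d. -/
theorem etaMultFormula_mul_T_iff {γ : SL(2, ℤ)} (hc : Even (γ 1 0)) (hd : 0 < γ 1 1)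
    (hcd : 0 < γ 1 0 + γ 1 1) : EtaMultFormula (γ * T ^ (1 : ℤ)) ↔ EtaMultFormula γ := by
  obtain ⟨h00, h01, h10, h11⟩ := mul_T_zpow_apply γ 1
  rw [EtaMultFormula, EtaMultFormula, lift_mul_T_zpow, map_mul, etaMult_lift_T_zpow, h10, h11,
    mul_one]
  have hdet := det_eq γ
  have he : etaExponent (γ * T ^ (1 : ℤ)) = etaExponent γ + 1 +
      (3 * γ 1 0 * (1 - γ 1 0) - γ 1 0 * (γ 1 0 ^ 2 - 1) * (γ 0 0 + 2 * γ 0 1)) := by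
    rw [etaExponent, etaExponent, h00, h01, h10, h11]
    linear_combination (1 - γ 1 0 ^ 2) * hdet
  set a := γ 0 0
  set b := γ 0 1
  set c := γ 1 0
  set d := γ 1 1
  obtain ⟨e, hce⟩ := hc
  have hodd : Odd d := by
    rcases Int.even_or_odd d with ⟨f, hf⟩ | h
    · exfalso
      have h0 : 2 * (a * f - b * e) = 1 := by linear_combination hdet - a * hf + b * hce
      omega
    · exact h
  have hmod : d % 4 = 1 ∨ d % 4 = 3 := by
    obtain ⟨f, hf⟩ := hodd
    omega
  have h3 : (3 : ℤ) ∣ 3 * c * (1 - c) - c * (c ^ 2 - 1) * (a + 2 * b) := by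
    obtain ⟨m, hm⟩ := six_dvd_mul_one_sub_sq c
    exact ⟨c * (1 - c) + 2 * m * (a + 2 * b), by linear_combination (a + 2 * b) * hm⟩
  have h8 : ((3 * c * (1 - c) - c * (c ^ 2 - 1) * (a + 2 * b) : ℤ) : ZMod 8)
      = if Odd e ∧ d % 4 = 1 then 4 else 0 := by
    have hd8 : (d : ZMod 8) * d = 1 := by
      have hsq : (8 : ℤ) ∣ d * d - 1 := by
        rw [← sq]; exact Int.eight_dvd_sq_sub_one_of_odd hodd
      have := (ZMod.intCast_zmod_eq_zero_iff_dvd _ 8).mpr hsq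
      push_cast at this
      exact sub_eq_zero.mp this
    have ha : (a : ZMod 8) = d * (1 + 2 * e * b) := by
      have h := congrArg (fun z : ℤ => (z : ZMod 8)) hdet
      have h' := congrArg (fun z : ℤ => (z : ZMod 8)) hce
      push_cast at h h'
      linear_combination (d : ZMod 8) * h - (a : ZMod 8) * hd8 + (b * d : ZMod 8) * h'
    have key := T_step_mod_eight e b d hd8
    have hval : ∀ z : ℤ, (((z : ZMod 8).val : ℕ) : ℤ) = z % 8 := fun z => ZMod.val_intCast z
    have hp : (Odd (e : ZMod 8).val ∧ (d : ZMod 8).val % 4 = 1) ↔ (Odd e ∧ d % 4 = 1) := by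
      have he8 := hval e
      have hd8 := hval d
      rw [Nat.odd_iff, Int.odd_iff]
      omega
    simp only [hp] at key
    rw [← key, ← ha, hce]
    push_cast
    ring
  have hz := zeta_zpow_sign h3 _ h8
  have hJ := jacobiSym_add_self (c := c) (n := d.toNat) (n' := (c + d).toNat)
    (by rw [Nat.odd_iff]; omega) (by rw [Nat.odd_iff]; omega)
    (by rw [Int.toNat_of_nonneg hd.le, Int.toNat_of_nonneg hcd.le, add_comm])
  have hp : ((c + d).toNat % 4 = 3 ∧ d.toNat % 4 = 1) ↔ (Odd e ∧ d % 4 = 1) := by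
    rw [Int.odd_iff]
    omega
  simp only [hp] at hJ
  rw [he, hJ, zpow_add, zpow_add, Circle.coe_mul, Circle.coe_mul, Circle.coe_mul, hz]
  have hs : (if Odd e ∧ d % 4 = 1 then -1 else 1 : ℂ) *
      (if Odd e ∧ d % 4 = 1 then -1 else 1) = 1 := by
    split_ifs <;> norm_num
  simp only [Int.cast_mul, Int.cast_ite, Int.cast_neg, Int.cast_one]
  constructor
  · intro h
    apply mul_right_cancel₀ (Circle.coe_ne_zero (zeta ^ (1 : ℤ)))
    rw [h]
    linear_combination (jacobiSym c d.toNat * ((zeta ^ etaExponent γ : Circle) : ℂ)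
      * ((zeta ^ (1 : ℤ) : Circle) : ℂ)) * hs
  · intro h
    rw [h]
    linear_combination (-jacobiSym c d.toNat * ((zeta ^ etaExponent γ : Circle) : ℂ)
      * ((zeta ^ (1 : ℤ) : Circle) : ℂ)) * hs

/-- Base of the descent: such a matrix is a power of T times a lower unipotent matrix, and both
multipliers are known. -/
theorem etaMultFormula_of_d_eq_one {γ : SL(2, ℤ)} (hd : γ 1 1 = 1) : EtaMultFormula γ := by
  have hdet := det_eq γ
  rw [hd] at hdet
  have hγ : γ = T ^ (γ 0 1) * lowerUnipotent (γ 1 0) := by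
    obtain ⟨h00, h01, h10, h11⟩ := T_zpow_mul_apply (lowerUnipotent (γ 1 0)) (γ 0 1)
    ext i j
    fin_cases i <;> fin_cases j
    · refine Eq.trans ?_ h00.symm
      simp [coe_lowerUnipotent]
      linarith
    · exact (h01.trans (by simp [coe_lowerUnipotent])).symm
    · exact (h10.trans (by simp [coe_lowerUnipotent])).symm
    · refine Eq.trans ?_ h11.symm
      simp [coe_lowerUnipotent, hd]
  have h : etaMult (lift γ) = zeta ^ (γ 0 1 + -γ 1 0) := by
    rw [zpow_add, ← etaMult_lift_T_zpow, ← etaMult_lift_lowerUnipotent, ← map_mul,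
      ← lift_T_zpow_mul, ← hγ]
  rw [EtaMultFormula, h, hd, etaExponent, hd]
  simp only [Int.toNat_one, jacobiSym.one_right, Int.cast_one, one_mul]
  congr 2
  linear_combination -γ 1 0 * hdet

/-- The value of the eta multiplier on the principal lift of a matrix with even lower left entry
and positive lower right entry. -/
theorem etaMultFormula_of_even {γ : SL(2, ℤ)} (hc : Even (γ 1 0)) (hd : 0 < γ 1 1) :
    EtaMultFormula γ := by
  obtain ⟨n, hn⟩ : ∃ n : ℕ, γ 1 1 = n := ⟨_, (Int.toNat_of_nonneg hd.le).symm⟩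
  induction n using Nat.strong_induction_on generalizing γ with
  | _ n ih =>
    rcases eq_or_ne n 1 with rfl | hn1
    · exact etaMultFormula_of_d_eq_one (by simpa using hn)
    have hdet := det_eq γ
    have hodd : (n : ℤ) % 2 = 1 := by
      obtain ⟨e, hce⟩ := hc
      by_contra hcon
      obtain ⟨f, hf⟩ : Even (n : ℤ) := by rw [Int.even_iff]; omega
      have h0 : 2 * (γ 0 0 * f - γ 0 1 * e) = 1 := by
        linear_combination hdet - γ 0 0 * hn - γ 0 0 * hf + γ 0 1 * hce
      omega
    -- Moves c to its residue modulo 2n in [-n, n). The value -n is excluded since c is even and n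
    -- odd, and 0 since n > 1 and the determinant is 1. Thus 0 < |c| < n, and T or its inverse,
    -- according to the sign of c, lowers d to n - |c| > 0.
    set k : ℤ := -((γ 1 0 + n) / (2 * n)) with hk
    refine etaMultFormula_of_mul_lowerUnipotent k hd ?_
    obtain ⟨-, -, h10, h11⟩ := mul_lowerUnipotent_apply γ (2 * k)
    set δ := γ * lowerUnipotent (2 * k)
    have hdetδ := det_eq δ
    rw [hn] at h10 h11
    have hn0 : (0 : ℤ) < n := by omega
    have hrange : -(n : ℤ) ≤ δ 1 0 ∧ δ 1 0 < n := by
      have h1 := Int.emod_nonneg (γ 1 0 + n) (b := 2 * n) (by omega)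
      have h2 := Int.emod_lt_of_pos (γ 1 0 + n) (b := 2 * n) (by omega)
      have h3 := Int.emod_add_mul_ediv (γ 1 0 + n) (2 * n)
      have h4 : δ 1 0 = (γ 1 0 + n) % (2 * n) - n := by
        rw [h10, hk]; linear_combination -h3
      omega
    have hcδ : Even (δ 1 0) := by
      rw [h10]
      exact hc.add (by simp)
    have hcδ2 : δ 1 0 % 2 = 0 := Int.even_iff.mp hcδ
    have hne : δ 1 0 ≠ 0 := by
      intro h0
      rw [h0, h11] at hdetδ
      have : (n : ℤ) ∣ 1 := ⟨δ 0 0, by linarith⟩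
      have := Int.le_of_dvd one_pos this
      omega
    rcases lt_or_gt_of_ne hne with hneg | hpos
    · obtain ⟨-, -, g10, g11⟩ := mul_T_zpow_apply δ 1
      rw [← etaMultFormula_mul_T_iff hcδ (by omega) (by omega)]
      exact ih (δ 1 0 + n).toNat (by omega) (by rw [g10]; exact hcδ) (by omega) (by omega)
    · obtain ⟨-, -, g10, g11⟩ := mul_T_zpow_apply δ (-1)
      have hback : δ = (δ * T ^ (-1 : ℤ)) * T ^ (1 : ℤ) := by
        rw [mul_assoc, ← zpow_add]; simp
      rw [hback, etaMultFormula_mul_T_iff (by rw [g10]; exact hcδ) (by omega) (by omega)]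
      exact ih (n - δ 1 0).toNat (by omega) (by rw [g10]; exact hcδ) (by omega) (by omega)

end EtaChar

end

noncomputable section

namespace EtaChar

/-! ### Characters of eta-quotients -/
open ModularGroup

/-- For `n ∣ c` the matrix `(a, n b; c / n, d)`, conjugate to `γ` under `τ ↦ n τ`. -/
def scaleMat (n : ℕ) (γ : SL(2, ℤ)) (h : (n : ℤ) ∣ γ 1 0) : SL(2, ℤ) :=
  ⟨!![γ 0 0, n * γ 0 1; γ 1 0 / n, γ 1 1], by
    rw [Matrix.det_fin_two_of, mul_comm (n : ℤ), mul_assoc, Int.mul_ediv_cancel' h]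
    exact det_eq γ⟩

theorem coe_scaleMat (n : ℕ) (γ : SL(2, ℤ)) (h : (n : ℤ) ∣ γ 1 0) :
    (scaleMat n γ h : Matrix (Fin 2) (Fin 2) ℤ) =
      !![γ 0 0, n * γ 0 1; γ 1 0 / n, γ 1 1] := rfl

/-- The point `n τ`. -/
def scalePoint (n : ℕ) (hn : 0 < n) (τ : UpperHalfPlane) : UpperHalfPlane :=
  ⟨n * τ, by
    simpa using mul_pos (Nat.cast_pos.mpr hn) τ.im_pos⟩

/-- The point `τ / n`. -/
def unscalePoint (n : ℕ) (hn : 0 < n) (τ : UpperHalfPlane) : UpperHalfPlane :=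
  ⟨(τ : ℂ) / n, by simpa [Complex.div_natCast_im] using div_pos τ.im_pos (Nat.cast_pos.mpr hn)⟩

theorem unscalePoint_scalePoint (n : ℕ) (hn : 0 < n) (τ : UpperHalfPlane) :
    unscalePoint n hn (scalePoint n hn τ) = τ := by
  ext
  simp [unscalePoint, scalePoint, hn.ne']

theorem coe_div_eq {n : ℕ} (hn : 0 < n) {c : ℤ} (h : (n : ℤ) ∣ c) :
    ((c / n : ℤ) : ℂ) = c / n := by
  rw [Int.cast_div h (by simpa using hn.ne')]
  simp

theorem autFactor_scaleMat (n : ℕ) (hn : 0 < n) (γ : SL(2, ℤ)) (h : (n : ℤ) ∣ γ 1 0)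
    (τ : UpperHalfPlane) :
    autFactor (scaleMat n γ h) τ = autFactor γ (unscalePoint n hn τ) := by
  simp [autFactor, coe_scaleMat, unscalePoint, coe_div_eq hn h]
  ring

theorem scaleMat_smul_scalePoint (n : ℕ) (hn : 0 < n) (γ : SL(2, ℤ)) (h : (n : ℤ) ∣ γ 1 0)
    (τ : UpperHalfPlane) :
    scaleMat n γ h • scalePoint n hn τ = scalePoint n hn (γ • τ) := by
  have hn' : (n : ℂ) ≠ 0 := by simpa using hn.ne'
  have haut := autFactor_ne_zero γ τ
  ext
  rw [UpperHalfPlane.coe_specialLinearGroup_apply]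
  simp only [scalePoint, UpperHalfPlane.coe_mk]
  rw [UpperHalfPlane.coe_specialLinearGroup_apply]
  simp [coe_scaleMat, coe_div_eq hn h]
  rw [autFactor] at haut
  field_simp

/-- The lift of `scaleMat` to the double cover. -/
def scale (n : ℕ) (hn : 0 < n) (x : DoubleCover) (h : (n : ℤ) ∣ x.mat 1 0) : DoubleCover where
  mat := scaleMat n x.mat h
  root := fun τ => x.root (unscalePoint n hn τ)
  exists_sign := by
    obtain ⟨ε, hε, hx⟩ := x.exists_sign
    refine ⟨ε, hε, fun τ => ?_⟩
    rw [hx, sqrtFactor, sqrtFactor, autFactor_scaleMat n hn]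

theorem scale_lift (n : ℕ) (hn : 0 < n) (γ : SL(2, ℤ)) (h : (n : ℤ) ∣ γ 1 0) :
    scale n hn (lift γ) h = lift (scaleMat n γ h) := by
  refine DoubleCover.ext rfl (funext fun τ => ?_)
  rw [root_lift, sqrtFactor, autFactor_scaleMat n hn]
  rfl

/-- γ acts on τ as `scaleMat` acts on nτ, with the same automorphy factor, so the transformation law
of η applies at nτ with the root of `x` unchanged. -/
theorem eta_mul_smul (n : ℕ) (hn : 0 < n) (x : DoubleCover) (h : (n : ℤ) ∣ x.mat 1 0)
    (τ : UpperHalfPlane) :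
    ModularForm.eta (n * ((x.mat • τ : UpperHalfPlane) : ℂ))
      = etaMult (scale n hn x h) * x.root τ * ModularForm.eta (n * (τ : ℂ)) := by
  have key := eta_smul (scale n hn x h) (scalePoint n hn τ)
  change ModularForm.eta ((scaleMat n x.mat h • scalePoint n hn τ : UpperHalfPlane) : ℂ) =
    _ * x.root (unscalePoint n hn (scalePoint n hn τ)) * _ at key
  rw [scaleMat_smul_scalePoint, unscalePoint_scalePoint] at key
  exact key

theorem dvd_lower_left {N : ℕ} (n : N.divisors) (x : Gamma0Cover N) :
    ((n : ℕ) : ℤ) ∣ x.1.mat 1 0 := by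
  have h : x.1.mat ∈ CongruenceSubgroup.Gamma0 N := x.2
  rw [CongruenceSubgroup.Gamma0_mem, ZMod.intCast_zmod_eq_zero_iff_dvd] at h
  exact (Int.natCast_dvd_natCast.mpr (Nat.dvd_of_mem_divisors n.2)).trans h

theorem divisor_pos {N : ℕ} (n : N.divisors) : 0 < (n : ℕ) := Nat.pos_of_mem_divisors n.2

/-- The element of the double cover governing the transformation of `η(n τ)` under `x`. -/
def scaled {N : ℕ} (n : N.divisors) (x : Gamma0Cover N) : DoubleCover :=
  scale n (divisor_pos n) x.1 (dvd_lower_left n x)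

theorem etaQuotient_ne_zero {N : ℕ} (r : Exponents N) (τ : UpperHalfPlane) :
    etaQuotient r τ ≠ 0 :=
  Finset.prod_ne_zero_iff.mpr fun n _ =>
    zpow_ne_zero _ (eta_ne_zero (scalePoint n (divisor_pos n) τ))

theorem zpow_sum_eq_prod {ι : Type*} {a : ℂ} (ha : a ≠ 0) (s : Finset ι) (f : ι → ℤ) :
    a ^ (∑ i ∈ s, f i) = ∏ i ∈ s, a ^ f i := by
  classical
  induction s using Finset.induction_on with
  | empty => simp
  | insert i s hi ih => rw [Finset.sum_insert hi, Finset.prod_insert hi, zpow_add₀ ha, ih]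

theorem coe_prod_zpow_circle {ι : Type*} (s : Finset ι) (v : ι → Circle) (f : ι → ℤ) :
    ((∏ i ∈ s, v i ^ f i : Circle) : ℂ) = ∏ i ∈ s, (v i : ℂ) ^ f i := by
  classical
  induction s using Finset.induction_on with
  | empty => simp
  | insert i s hi ih =>
    rw [Finset.prod_insert hi, Finset.prod_insert hi, Circle.coe_mul, ih, Circle.coe_zpow]

theorem slash_etaQuotient {N : ℕ} (r : Exponents N) (x : Gamma0Cover N) (τ : UpperHalfPlane) :
    slash (∑ n, r n) (etaQuotient r) x τ
      = ((∏ n, etaMult (scaled n x) ^ r n : Circle) : ℂ) * etaQuotient r τ := by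
  have hr := x.1.root_ne_zero τ
  have h : etaQuotient r (x.1.mat • τ) = (∏ n, (etaMult (scaled n x) : ℂ) ^ r n)
      * x.1.root τ ^ (∑ n, r n) * etaQuotient r τ := by
    rw [etaQuotient, etaQuotient, zpow_sum_eq_prod hr, ← Finset.prod_mul_distrib,
      ← Finset.prod_mul_distrib]
    refine Finset.prod_congr rfl fun n _ => ?_
    rw [eta_mul_smul n (divisor_pos n) x.1 (dvd_lower_left n x), mul_zpow, mul_zpow]
    rfl
  rw [slash, h, zpow_neg, coe_prod_zpow_circle]
  field_simp

theorem slash_mul (m : ℤ) (f : UpperHalfPlane → ℂ) (x y : DoubleCover) (τ : UpperHalfPlane) :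
    slash m f (x * y) τ = slash m (slash m f x) y τ := by
  rw [slash, slash, slash, DoubleCover.root_mul, DoubleCover.mat_mul, mul_smul, mul_zpow]
  ring

/-- The character of an eta-quotient. -/
def etaChar {N : ℕ} (r : Exponents N) : Gamma0Cover N →* Circle :=
  MonoidHom.mk' (fun x => ∏ n, etaMult (scaled n x) ^ r n) fun x y => by
    ext
    -- Multiplicativity follows from slash being a right action and the eta-quotient being nonzero
    -- at i, without checking that scaling respects products.
    apply mul_right_cancel₀ (etaQuotient_ne_zero r UpperHalfPlane.I)
    rw [← slash_etaQuotient, Subgroup.coe_mul, slash_mul, slash, slash_etaQuotient,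
      Circle.coe_mul, mul_assoc, ← slash_etaQuotient r y, slash]
    ring

theorem etaChar_apply {N : ℕ} (r : Exponents N) (x : Gamma0Cover N) :
    etaChar r x = ∏ n, etaMult (scaled n x) ^ r n := rfl

theorem isCharacterOf_iff {N : ℕ} {χ : Gamma0Cover N →* Circle} {r : Exponents N} :
    IsCharacterOf χ r ↔ χ = etaChar r := by
  constructor
  · intro h
    ext x
    have := h x UpperHalfPlane.I
    rw [slash_etaQuotient] at this
    exact (mul_right_cancel₀ (etaQuotient_ne_zero r _) this).symm
  · rintro rfl x τ
    exact slash_etaQuotient r x τ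

theorem etaChar_sub {N : ℕ} (r s : Exponents N) : etaChar (r - s) = etaChar r * (etaChar s)⁻¹ := by
  ext x
  simp [etaChar_apply, zpow_sub, Finset.prod_mul_distrib, Finset.prod_inv_distrib]

theorem etaChar_eq_iff {N : ℕ} (r s : Exponents N) :
    etaChar r = etaChar s ↔ etaChar (r - s) = 1 := by
  rw [etaChar_sub, mul_inv_eq_one]

end EtaChar

end

noncomputable section

namespace EtaChar

/-! ### Eta-quotients of weight zero -/
open ModularGroup

theorem scaleMat_congr (n : ℕ) {γ δ : SL(2, ℤ)} (hγ : (n : ℤ) ∣ γ 1 0) (hδ : (n : ℤ) ∣ δ 1 0)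
    (h : γ = δ) : scaleMat n γ hγ = scaleMat n δ hδ := by
  subst h
  rfl

theorem divisor_dvd {N : ℕ} (n : N.divisors) : ((n : ℕ) : ℤ) ∣ N :=
  Int.natCast_dvd_natCast.mpr (Nat.dvd_of_mem_divisors n.2)

/-- Changing the root by a sign ε multiplies the character by ε^{Σ r_n} = 1. Thus lifts that are
multiplicative only up to sign suffice in weight 0. -/
theorem etaChar_eq_of_mat_eq {N : ℕ} {r : Exponents N} (hr : ∑ n, r n = 0) {x y : Gamma0Cover N}
    (h : x.1.mat = y.1.mat) : etaChar r x = etaChar r y := by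
  obtain ⟨ε, hε, hroot⟩ := exists_sign_of_mat_eq h
  have hε0 : ε ≠ 0 := by rintro rfl; simp at hε
  have hv : ∀ n : N.divisors, (etaMult (scaled n x) : ℂ) = ε * etaMult (scaled n y) := fun n => by
    refine etaMult_of_mat_eq hε ?_ fun τ => hroot _
    exact scaleMat_congr n (dvd_lower_left n x) (dvd_lower_left n y) h
  ext
  rw [etaChar_apply, etaChar_apply, coe_prod_zpow_circle, coe_prod_zpow_circle]
  simp only [hv, mul_zpow]
  rw [Finset.prod_mul_distrib, ← zpow_sum_eq_prod hε0, hr, zpow_zero, one_mul]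

theorem mem_gamma0_iff_dvd {N : ℕ} {γ : SL(2, ℤ)} :
    γ ∈ CongruenceSubgroup.Gamma0 N ↔ (N : ℤ) ∣ γ 1 0 := by
  rw [CongruenceSubgroup.Gamma0_mem, ZMod.intCast_zmod_eq_zero_iff_dvd]

/-- The principal lift of a matrix of `Γ₀(N)`. -/
def gammaLift {N : ℕ} (γ : SL(2, ℤ)) (h : (N : ℤ) ∣ γ 1 0) : Gamma0Cover N :=
  ⟨lift γ, mem_gamma0_iff_dvd.mpr h⟩

theorem etaChar_gammaLift {N : ℕ} (r : Exponents N) (γ : SL(2, ℤ)) (h : (N : ℤ) ∣ γ 1 0) :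
    etaChar r (gammaLift γ h) = ∏ n : N.divisors,
      etaMult (lift (scaleMat n γ ((divisor_dvd n).trans h))) ^ r n := by
  rw [etaChar_apply]
  refine Finset.prod_congr rfl fun n _ => ?_
  exact congrArg (fun y => etaMult y ^ r n) (scale_lift n (divisor_pos n) γ _)

theorem T_zpow_lower_left (N : ℕ) (k : ℤ) : (N : ℤ) ∣ (T ^ k) 1 0 := by
  simp [coe_T_zpow]

theorem scaleMat_T_zpow (n : ℕ) (k : ℤ) (h : (n : ℤ) ∣ (T ^ k) 1 0) :
    scaleMat n (T ^ k) h = T ^ (n * k) := by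
  apply Subtype.ext
  rw [coe_scaleMat, coe_T_zpow, coe_T_zpow]
  simp

theorem prod_zeta_zpow {ι : Type*} (s : Finset ι) (f : ι → ℤ) :
    ∏ i ∈ s, zeta ^ f i = zeta ^ ∑ i ∈ s, f i := by
  classical
  induction s using Finset.induction_on with
  | empty => simp
  | insert i s hi ih => rw [Finset.sum_insert hi, Finset.prod_insert hi, zpow_add, ih]

theorem etaChar_T_zpow {N : ℕ} (r : Exponents N) (k : ℤ) :
    etaChar r (gammaLift (T ^ k) (T_zpow_lower_left N k))
      = zeta ^ (k * ∑ n : N.divisors, ((n : ℕ) : ℤ) * r n) := by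
  rw [etaChar_gammaLift, Finset.mul_sum, ← prod_zeta_zpow]
  refine Finset.prod_congr rfl fun n _ => ?_
  rw [scaleMat_T_zpow, etaMult_lift_T_zpow, ← zpow_mul]
  ring_nf

theorem lowerUnipotent_lower_left (N : ℕ) (k : ℤ) : (N : ℤ) ∣ (lowerUnipotent (N * k)) 1 0 := by
  simp [coe_lowerUnipotent]

theorem scaleMat_lowerUnipotent (n m : ℕ) (hn : 0 < n) (k : ℤ)
    (h : (n : ℤ) ∣ (lowerUnipotent ((n * m : ℕ) * k)) 1 0) :
    scaleMat n (lowerUnipotent ((n * m : ℕ) * k)) h = lowerUnipotent (m * k) := by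
  apply Subtype.ext
  rw [coe_scaleMat, coe_lowerUnipotent, coe_lowerUnipotent]
  have : (n : ℤ) ≠ 0 := by exact_mod_cast hn.ne'
  have h' : ((n * m : ℕ) : ℤ) * k / n = m * k :=
    Int.ediv_eq_of_eq_mul_right this (by push_cast; ring)
  simpa using h'

theorem etaChar_lowerUnipotent {N : ℕ} (r : Exponents N) (k : ℤ) :
    etaChar r (gammaLift (lowerUnipotent (N * k)) (lowerUnipotent_lower_left N k))
      = zeta ^ (-k * ∑ n : N.divisors, ((N / (n : ℕ) : ℕ) : ℤ) * r n) := by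
  rw [etaChar_gammaLift, Finset.mul_sum, ← prod_zeta_zpow]
  refine Finset.prod_congr rfl fun n _ => ?_
  have key : ∀ h, scaleMat n (lowerUnipotent (N * k)) h =
      lowerUnipotent ((N / (n : ℕ) : ℕ) * k) := by
    intro h
    have hN : (n : ℕ) * (N / n) = N := Nat.mul_div_cancel' (Nat.dvd_of_mem_divisors n.2)
    have h' := scaleMat_lowerUnipotent n (N / n) (divisor_pos n) k
    rw [hN] at h'
    exact h' h
  rw [key, etaMult_lift_lowerUnipotent, ← zpow_mul]
  ring_nf

theorem jacobiSym_prod_left {ι : Type*} (s : Finset ι) (f : ι → ℕ) (d : ℕ) :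
    jacobiSym ((∏ i ∈ s, f i : ℕ) : ℤ) d = ∏ i ∈ s, jacobiSym (f i) d := by
  classical
  induction s using Finset.induction_on with
  | empty => simp
  | insert i s hi ih =>
    rw [Finset.prod_insert hi, Finset.prod_insert hi, Nat.cast_mul, jacobiSym.mul_left, ih]

theorem sign_zpow {j : ℤ} (hj : j = 1 ∨ j = -1) (k : ℤ) [Decidable (Odd k)] :
    (j : ℂ) ^ k = if Odd k then (j : ℂ) else 1 := by
  rcases hj with rfl | rfl
  · simp
  · split_ifs with h
    · simpa using h.neg_one_zpow
    · simpa using (Int.not_odd_iff_even.mp h).neg_one_zpow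

/-- The character of an eta-quotient of weight `0` on matrices close to a diagonal one. -/
theorem etaChar_gammaLift_eq_jacobiSym {N : ℕ} {r : Exponents N} (hr : ∑ n, r n = 0)
    {γ : SL(2, ℤ)} (h : (N : ℤ) ∣ γ 1 0) (hc : (24 * N : ℤ) ∣ γ 1 0) (hb : (24 : ℤ) ∣ γ 0 1)
    (hd : 0 < γ 1 1) :
    (etaChar r (gammaLift γ h) : ℂ) = jacobiSym (oddPart r) (γ 1 1).toNat := by
  have hdet := det_eq γ
  have hcop : IsCoprime (γ 1 0) (γ 1 1) := ⟨-γ 0 1, γ 0 0, by linarith⟩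
  have hgcd : ∀ e : ℤ, e ∣ γ 1 0 → e.gcd ((γ 1 1).toNat : ℕ) = 1 := fun e he => by
    rw [Int.toNat_of_nonneg hd.le]
    exact Int.isCoprime_iff_gcd_eq_one.mp (hcop.of_isCoprime_of_dvd_left he)
  -- Modulo 24 the exponent reduces to 3d - 3 for every n, and the symbol of c/n is (c/d)(n/d). The
  -- factors independent of n disappear in weight 0.
  have hval : ∀ n : N.divisors,
      (etaMult (lift (scaleMat n γ ((divisor_dvd n).trans h))) : ℂ)
      = (jacobiSym (γ 1 0) (γ 1 1).toNat : ℂ) * (jacobiSym (n : ℕ) (γ 1 1).toNat : ℂ)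
        * ((zeta ^ (3 * γ 1 1 - 3) : Circle) : ℂ) := by
    intro n
    have hn0 : ((n : ℕ) : ℤ) ≠ 0 := by exact_mod_cast (divisor_pos n).ne'
    obtain ⟨m, hm⟩ := divisor_dvd n
    obtain ⟨q, hq⟩ := hc
    obtain ⟨s, hs⟩ := hb
    have hcn : γ 1 0 / (n : ℕ) = 24 * (m * q) :=
      Int.ediv_eq_of_eq_mul_right hn0 (by rw [hq, hm]; ring)
    have hmul : γ 1 0 = (n : ℕ) * (24 * (m * q)) := by rw [hq, hm]; ring
    set δ := scaleMat n γ ((divisor_dvd n).trans h)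
    have h00 : δ 0 0 = γ 0 0 := rfl
    have h01 : δ 0 1 = (n : ℕ) * γ 0 1 := rfl
    have h10 : δ 1 0 = 24 * (m * q) := hcn
    have h11 : δ 1 1 = γ 1 1 := rfl
    have hf := etaMultFormula_of_even (γ := δ) (by rw [h10]; exact ⟨12 * (m * q), by ring⟩)
      (h11 ▸ hd)
    rw [EtaMultFormula, h10, h11, etaExponent, h00, h01, h10, h11, hs] at hf
    rw [hf]
    congr 1
    · rw [hmul, jacobiSym.mul_left (n : ℕ) (24 * (m * q))]
      have := jacobiSym.sq_one (hgcd (n : ℕ) ⟨_, hmul⟩)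
      have h2 : ((jacobiSym (n : ℕ) (γ 1 1).toNat : ℤ) : ℂ) ^ 2 = 1 := by exact_mod_cast this
      rw [Int.cast_mul]
      linear_combination (-(jacobiSym (24 * (m * q)) (γ 1 1).toNat : ℂ)) * h2
    · congr 1
      apply zeta_zpow_congr
      refine ⟨(γ 0 0 + γ 1 1) * (m * q) - (n : ℕ) * s * γ 1 1 * ((24 * (m * q)) ^ 2 - 1)
        - 3 * (m * q) * γ 1 1, by ring⟩
  have hJc : ((jacobiSym (γ 1 0) (γ 1 1).toNat : ℤ) : ℂ) ≠ 0 := by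
    exact_mod_cast jacobiSym.ne_zero (hgcd _ dvd_rfl)
  rw [etaChar_gammaLift, coe_prod_zpow_circle]
  simp only [hval, mul_zpow]
  rw [Finset.prod_mul_distrib, Finset.prod_mul_distrib, ← zpow_sum_eq_prod hJc,
    ← zpow_sum_eq_prod (Circle.coe_ne_zero _), hr, zpow_zero, zpow_zero, one_mul, mul_one, oddPart,
    jacobiSym_prod_left, Finset.prod_filter, Int.cast_prod]
  refine Finset.prod_congr rfl fun n _ => ?_
  rw [sign_zpow (jacobiSym.eq_one_or_neg_one
    (hgcd (n : ℕ) ((divisor_dvd n).trans h))) (r n)]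
  split_ifs <;> simp

theorem exists_shift_coprime_six {a b c d : ℤ} (hdet : a * d - b * c = 1) (hc : c ≠ 0) :
    ∃ k : ℤ, 0 < c * k + d ∧ (c * k + d) % 2 = 1 ∧ (c * k + d) % 3 ≠ 0 := by
  have h2 : ¬(c % 2 = 0 ∧ d % 2 = 0) := by
    rintro ⟨hc2, hd2⟩
    obtain ⟨e, he⟩ := Int.dvd_of_emod_eq_zero hc2
    obtain ⟨f, hf⟩ := Int.dvd_of_emod_eq_zero hd2
    have : 2 * (a * f - b * e) = 1 := by linear_combination hdet - a * hf + b * he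
    omega
  have h3 : ¬(c % 3 = 0 ∧ d % 3 = 0) := by
    rintro ⟨hc2, hd2⟩
    obtain ⟨e, he⟩ := Int.dvd_of_emod_eq_zero hc2
    obtain ⟨f, hf⟩ := Int.dvd_of_emod_eq_zero hd2
    have : 3 * (a * f - b * e) = 1 := by linear_combination hdet - a * hf + b * he
    omega
  -- The values 4, 0, 1, 3 settle the residues modulo 2 and 3, as c and d have no common factor 2 or
  -- 3. The later shift of k by a multiple of 6c adds a multiple of 6c², giving positivity without
  -- changing the residues.
  obtain ⟨k, hk2, hk3⟩ : ∃ k : ℤ, (c * k + d) % 2 = 1 ∧ (c * k + d) % 3 ≠ 0 := by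
    by_cases hd2 : d % 2 = 1 <;> by_cases hd3 : d % 3 = 0
    · exact ⟨4, by omega, by omega⟩
    · exact ⟨0, by omega, by omega⟩
    · exact ⟨1, by omega, by omega⟩
    · exact ⟨3, by omega, by omega⟩
  have hm : c * (k + 6 * (c * (|c * k + d| + 1))) + d
      = c * k + d + 6 * (c ^ 2 * (|c * k + d| + 1)) := by ring
  refine ⟨k + 6 * (c * (|c * k + d| + 1)), ?_, by omega, by omega⟩
  have h1 : 0 < c ^ 2 := by positivity
  have h4 := neg_abs_le (c * k + d)
  have h5 := abs_nonneg (c * k + d)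
  rw [hm]
  nlinarith

/-- The unit group of ℤ/24 has exponent 2. This drives both the normal form of matrices and the
splitting off of primes p ≥ 5. -/
theorem dvd_one_sub_sq {d : ℤ} (h2 : d % 2 = 1) (h3 : d % 3 ≠ 0) : (24 : ℤ) ∣ 1 - d * d := by
  have h : ∀ x : ZMod 24, x.val % 2 = 1 → x.val % 3 ≠ 0 → 1 - x * x = 0 := by decide
  have hval : (((d : ZMod 24).val : ℕ) : ℤ) = d % 24 := ZMod.val_intCast d
  have h' := h d (by omega) (by omega)
  exact (ZMod.intCast_zmod_eq_zero_iff_dvd (1 - d * d) 24).mp (by push_cast; exact h')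

/-- Every matrix of `Γ₀(N)` is close to a diagonal one up to unipotent factors. -/
theorem exists_normal_form {N : ℕ} (hN : 0 < N) {γ : SL(2, ℤ)} (h : (N : ℤ) ∣ γ 1 0) :
    ∃ i j k l : ℤ, ∃ δ : SL(2, ℤ),
      δ = T ^ i * (γ * lowerUnipotent (N * j) * T ^ k * lowerUnipotent (N * l)) ∧
      (24 * N : ℤ) ∣ δ 1 0 ∧ (24 : ℤ) ∣ δ 0 1 ∧ 0 < δ 1 1 := by
  -- A nonzero lower left entry is needed before d can be shifted to a value prime to 6.
  obtain ⟨j, hj⟩ : ∃ j : ℤ, (γ * lowerUnipotent (N * j)) 1 0 ≠ 0 := by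
    by_cases h0 : γ 1 0 = 0
    · refine ⟨1, ?_⟩
      rw [(mul_lowerUnipotent_apply γ _).2.2.1, h0, zero_add, mul_one]
      have hdet := det_eq γ
      rw [h0] at hdet
      refine mul_ne_zero (fun h1 => ?_) (by exact_mod_cast hN.ne')
      rw [h1] at hdet
      simp at hdet
    · refine ⟨0, ?_⟩
      rw [(mul_lowerUnipotent_apply γ _).2.2.1]
      simpa using h0
  have hα : (N : ℤ) ∣ (γ * lowerUnipotent (N * j)) 1 0 := by
    rw [(mul_lowerUnipotent_apply γ _).2.2.1]
    exact dvd_add h ⟨γ 1 1 * j, by ring⟩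
  set α := γ * lowerUnipotent (N * j)
  obtain ⟨k, hpos, hk2, hk3⟩ := exists_shift_coprime_six (det_eq α) hj
  obtain ⟨-, -, b10, b11⟩ := mul_T_zpow_apply α k
  set β := α * T ^ k
  rw [← b11] at hpos hk2 hk3
  obtain ⟨e, he⟩ := hα
  obtain ⟨m, hm⟩ := dvd_one_sub_sq hk2 hk3
  -- With lower left entry Ne and lower right entry d, this factor makes the former Ne(1 - d²); the
  -- final power of T makes the upper right entry b(1 - d²). Both gain the divisor 24.
  obtain ⟨-, c01, c10, c11⟩ := mul_lowerUnipotent_apply β (N * (-(β 1 1 * e)))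
  set κ := β * lowerUnipotent (N * (-(β 1 1 * e)))
  obtain ⟨-, d01, d10, d11⟩ := T_zpow_mul_apply κ (-(β 0 1 * β 1 1))
  refine ⟨-(β 0 1 * β 1 1), j, k, -(β 1 1 * e), _, rfl, ?_, ?_, ?_⟩
  · rw [d10, c10, b10, he]
    exact ⟨e * m, by linear_combination N * e * hm⟩
  · rw [d01, c01, c11]
    exact ⟨β 0 1 * m, by linear_combination β 0 1 * hm⟩
  · rw [d11, c11]
    exact hpos

end EtaChar

end

noncomputable section

namespace EtaChar

/-! ### The kernel of the character map -/
open ModularGroup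

theorem isSquare_iff_even_factorization {n : ℕ} (hn : n ≠ 0) :
    IsSquare n ↔ ∀ p, p.Prime → Even (n.factorization p) := by
  constructor
  · rintro ⟨m, rfl⟩ p -
    have hm : m ≠ 0 := by rintro rfl; simp at hn
    rw [Nat.factorization_mul hm hm]
    exact ⟨_, rfl⟩
  · intro h
    refine ⟨∏ p ∈ n.primeFactors, p ^ (n.factorization p / 2), ?_⟩
    rw [← Finset.prod_mul_distrib]
    conv_lhs => rw [← Nat.prod_factorization_pow_eq_self hn]
    refine Finset.prod_congr rfl fun p hp => ?_
    rw [← pow_add, ← two_mul,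
      Nat.two_mul_div_two_of_even (h p (Nat.prime_of_mem_primeFactors hp))]

theorem jacobiSym_eq_one_of_mod {m d : ℕ} (hm : 0 < m) (h : d ≡ 1 [MOD 4 * m]) :
    jacobiSym m d = 1 := by
  have h4 : d % 4 = 1 := (h.of_dvd (Dvd.intro _ rfl) : d ≡ 1 [MOD 4])
  have hodd : Odd d := Nat.odd_iff.mpr (by omega)
  have h1 : d % (4 * m) = 1 := by
    rw [h, Nat.mod_eq_of_lt (by omega)]
  rw [jacobiSym.mod_right' m hodd, h1, jacobiSym.one_right]

/-- A positive integer that is not a square is a nonresidue for some modulus prime to a given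
number. -/
theorem exists_jacobiSym_eq_neg_one {P M : ℕ} (hP : P ≠ 0) (hM : M ≠ 0) (h : ¬IsSquare P) :
    ∃ d : ℕ, 0 < d ∧ d.Coprime M ∧ jacobiSym P d = -1 := by
  rw [isSquare_iff_even_factorization hP] at h
  push Not at h
  obtain ⟨q, hq, hv⟩ := h
  have hv' : Odd (P.factorization q) := Nat.not_even_iff_odd.mp hv
  have : Fact q.Prime := ⟨hq⟩
  have hK : 8 * M * P ≠ 0 := by positivity
  -- Only the Chinese remainder theorem is used; d need not be prime. The condition d ≡ 1 mod L
  -- gives coprimality away from q and, by reciprocity, (P'/d) = 1. The condition at q gives (q/d) =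
  -- -1, which survives because q has odd valuation in P. For odd q the factor 8 ensures 4P' ∣ L.
  set L := ordCompl[q] (8 * M * P) with hL
  set P' := ordCompl[q] P with hP'
  have hP'0 : 0 < P' := Nat.ordCompl_pos q hP
  have hPL : P' ∣ L := Nat.ordCompl_dvd_ordCompl_of_dvd (Dvd.intro_left _ rfl) q
  have hcopL : q.Coprime L := Nat.coprime_ordCompl hq hK
  have hPeq : P = q ^ P.factorization q * P' := (Nat.ordProj_mul_ordCompl_eq_self P q).symm
  suffices H : ∃ d : ℕ, d.Coprime q ∧ d.Coprime L ∧ jacobiSym q d = -1 ∧ jacobiSym P' d = 1 by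
    obtain ⟨d, h1, h2, h3, h4⟩ := H
    refine ⟨d, Nat.pos_of_ne_zero ?_, ?_, ?_⟩
    · rintro rfl
      rw [jacobiSym.zero_right] at h3
      norm_num at h3
    · have : d.Coprime (8 * M * P) := by
        rw [← Nat.ordProj_mul_ordCompl_eq_self (8 * M * P) q]
        exact Nat.Coprime.mul_right (h1.pow_right _) h2
      exact this.coprime_dvd_right ⟨8 * P, by ring⟩
    · rw [hPeq, Nat.cast_mul, Nat.cast_pow, jacobiSym.mul_left, jacobiSym.pow_left, h3, h4,
        hv'.neg_one_pow, mul_one]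
  rcases hq.eq_two_or_odd' with rfl | hodd
  · obtain ⟨d, hd8, hdL⟩ := Nat.chineseRemainder (n := 8) (m := L)
      (Nat.Coprime.pow_left 3 hcopL) 5 1
    have hd8' : d % 8 = 5 := hd8
    have hdodd : Odd d := Nat.odd_iff.mpr (by omega)
    have hP'odd : Odd P' := by
      rw [Nat.odd_iff, ← Nat.two_dvd_ne_zero]
      exact Nat.not_dvd_ordCompl hq hP
    refine ⟨d, ?_, ?_, ?_, ?_⟩
    · exact Nat.coprime_two_right.mpr hdodd
    · rw [Nat.Coprime, Nat.ModEq.gcd_eq hdL, Nat.gcd_one_left]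
    · rw [Nat.cast_ofNat, jacobiSym.at_two hdodd, ← ZMod.natCast_mod, hd8']
      rfl
    · rw [jacobiSym.quadratic_reciprocity_one_mod_four' hP'odd (by omega)]
      have : ((d : ℤ)) % (P' : ℕ) = 1 % (P' : ℕ) := by
        exact_mod_cast (hdL.of_dvd hPL)
      rw [jacobiSym.mod_left' this, jacobiSym.one_left]
  · obtain ⟨a, ha⟩ := FiniteField.exists_nonsquare (F := ZMod q)
      (by rw [ZMod.ringChar_zmod_n]; rintro rfl; exact absurd hodd (by decide))
    obtain ⟨d, hdq, hdL⟩ := Nat.chineseRemainder hcopL a.val 1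
    have hda : ((d : ℤ) : ZMod q) = a := by
      rw [Int.cast_natCast, (ZMod.natCast_eq_natCast_iff _ _ _).mpr hdq, ZMod.natCast_zmod_val]
    have hleg : jacobiSym d q = -1 := by
      rw [← jacobiSym.legendreSym.to_jacobiSym, legendreSym.eq_neg_one_iff, hda]
      exact ha
    have h4L : 4 * P' ∣ L := by
      have h8 : ordCompl[q] 8 = 8 := by
        rw [Nat.factorization_eq_zero_of_not_dvd, pow_zero, Nat.div_one]
        intro hdvd
        have := (Nat.prime_dvd_prime_iff_eq hq Nat.prime_two).mp
          (hq.dvd_of_dvd_pow (show q ∣ 2 ^ 3 from hdvd))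
        rw [this] at hodd
        exact absurd hodd (by decide)
      rw [hL, Nat.ordCompl_mul, Nat.ordCompl_mul, h8]
      exact mul_dvd_mul (Dvd.dvd.mul_right (by norm_num) _) dvd_rfl
    have hd4 : d ≡ 1 [MOD 4 * P'] := hdL.of_dvd h4L
    have hd4' : d % 4 = 1 := (hd4.of_dvd (Dvd.intro _ rfl) : d ≡ 1 [MOD 4])
    refine ⟨d, ?_, ?_, ?_, jacobiSym_eq_one_of_mod hP'0 hd4⟩
    · rw [Nat.coprime_comm, hq.coprime_iff_not_dvd]
      intro hdvd
      have : ((d : ℤ) : ZMod q) = 0 := by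
        rw [Int.cast_natCast]; exact (ZMod.natCast_eq_zero_iff _ _).mpr hdvd
      rw [hda] at this
      exact ha (this ▸ IsSquare.zero)
    · rw [Nat.Coprime, Nat.ModEq.gcd_eq hdL, Nat.gcd_one_left]
    · rw [jacobiSym.quadratic_reciprocity_one_mod_four' hodd hd4', hleg]

theorem oddPart_pos {N : ℕ} (r : Exponents N) : 0 < oddPart r :=
  Finset.prod_pos fun n _ => divisor_pos n

theorem etaChar_T_eq_one_iff {N : ℕ} (r : Exponents N) :
    (∀ k, etaChar r (gammaLift (T ^ k) (T_zpow_lower_left N k)) = 1) ↔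
      (24 : ℤ) ∣ ∑ n : N.divisors, ((n : ℕ) : ℤ) * r n := by
  simp only [etaChar_T_zpow, zeta_zpow_eq_one_iff]
  exact ⟨fun h => by simpa using h 1, fun h k => h.mul_left k⟩

theorem etaChar_lowerUnipotent_eq_one_iff {N : ℕ} (r : Exponents N) :
    (∀ k, etaChar r (gammaLift (lowerUnipotent (N * k)) (lowerUnipotent_lower_left N k)) = 1) ↔
      (24 : ℤ) ∣ ∑ n : N.divisors, ((N / (n : ℕ) : ℕ) : ℤ) * r n := by
  simp only [etaChar_lowerUnipotent, zeta_zpow_eq_one_iff]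
  exact ⟨fun h => by simpa using h (-1), fun h k => h.mul_left (-k)⟩

/-- The eta-quotients of weight `0` with trivial character. -/
theorem etaChar_eq_one_iff {N : ℕ} (hN : 0 < N) {r : Exponents N} (hr : ∑ n, r n = 0) :
    etaChar r = 1 ↔ r ∈ Z N := by
  constructor
  · intro h
    refine ⟨hr, ?_, ?_, ?_⟩
    · exact (etaChar_T_eq_one_iff r).mp fun k => by rw [h]; rfl
    · exact (etaChar_lowerUnipotent_eq_one_iff r).mp fun k => by rw [h]; rfl
    · by_contra hsq
      -- 576 = 24²: the Bézout relation for d and 576N is the determinant of a matrix with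
      -- off-diagonal entries -24v and 24N.
      obtain ⟨d, hd0, hcop, hJ⟩ := exists_jacobiSym_eq_neg_one (M := 576 * N) (oddPart_pos r).ne'
        (by positivity) hsq
      obtain ⟨u, v, huv⟩ := Nat.isCoprime_iff_coprime.mpr hcop
      push_cast at huv
      let γ : SL(2, ℤ) := ⟨!![u, -24 * v; 24 * N, d], by
        rw [Matrix.det_fin_two_of]; linear_combination huv⟩
      have hγ : (N : ℤ) ∣ γ 1 0 := Dvd.intro_left 24 rfl
      have key := etaChar_gammaLift_eq_jacobiSym hr (γ := γ) hγ dvd_rfl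
        ⟨-v, by simp [γ]⟩ (by simpa [γ] using hd0)
      rw [h, show (γ 1 1).toNat = d by simp [γ], hJ] at key
      simp at key
      norm_num at key
  · rintro ⟨-, h1, h2, h3⟩
    rw [← etaChar_T_eq_one_iff] at h1
    rw [← etaChar_lowerUnipotent_eq_one_iff] at h2
    ext x
    have hx : (N : ℤ) ∣ x.1.mat 1 0 := mem_gamma0_iff_dvd.mp x.2
    obtain ⟨i, j, k, l, δ, hδ, hc, hb, hd⟩ := exists_normal_form hN hx
    have hδN : (N : ℤ) ∣ δ 1 0 := (Dvd.intro_left 24 rfl).trans hc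
    -- The product of lifts need only have the matrix δ; the unipotent factors contribute 1 by
    -- hypothesis.
    have heq := etaChar_eq_of_mat_eq hr (y := gammaLift δ hδN)
      (x := gammaLift (T ^ i) (T_zpow_lower_left N i) *
        (x * gammaLift (lowerUnipotent (N * j)) (lowerUnipotent_lower_left N j) *
          gammaLift (T ^ k) (T_zpow_lower_left N k) *
          gammaLift (lowerUnipotent (N * l)) (lowerUnipotent_lower_left N l))) hδ.symm
    simp only [map_mul, h1, h2, one_mul, mul_one] at heq
    rw [heq, etaChar_gammaLift_eq_jacobiSym hr hδN hc hb hd]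
    obtain ⟨s, hs⟩ := h3
    -- The symbol is a value on the unit circle, hence nonzero, which forces s to be prime to d.
    have hcop : (s : ℤ).gcd (δ 1 1).toNat = 1 := by
      have hJ : jacobiSym (oddPart r) (δ 1 1).toNat ≠ 0 := by
        intro h0
        have := etaChar_gammaLift_eq_jacobiSym hr hδN hc hb hd
        rw [h0, Int.cast_zero] at this
        exact Circle.coe_ne_zero _ this
      by_contra hne
      have : NeZero (δ 1 1).toNat := ⟨by omega⟩
      apply hJ
      rw [hs, Nat.cast_mul, jacobiSym.mul_left, jacobiSym.eq_zero_iff_not_coprime.mpr hne, zero_mul]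
    rw [hs, Nat.cast_mul, ← sq, jacobiSym.sq_one' hcop]
    simp

end EtaChar

end

noncomputable section

namespace EtaChar

/-! ### Invariants of exponent vectors -/

/-- The target of the three invariants of an exponent vector. -/
abbrev Invariants : Type := ZMod 24 × ZMod 24 × (ℕ → ZMod 2)

/-- The invariants of `e_n - e_1`. -/
def invVec (N n : ℕ) : Invariants :=
  ((n : ZMod 24) - 1, ((N / n : ℕ) : ZMod 24) - N, fun p => (n.factorization p : ZMod 2))

theorem invVec_one (N : ℕ) : invVec N 1 = 0 := by
  ext <;> simp [invVec]

theorem invariants_torsion (g : Invariants) : (24 : ℤ) • g = 0 := by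
  obtain ⟨x, y, z⟩ := g
  have h24 : ∀ x : ZMod 24, (24 : ℤ) • x = 0 := by decide
  have h2 : ∀ x : ZMod 2, (24 : ℤ) • x = 0 := by decide
  refine Prod.ext (h24 x) (Prod.ext (h24 y) (funext fun p => h2 (z p)))

/-- The invariants of an exponent vector of weight `0`. -/
def invariant (N : ℕ) : Exponents N →+ Invariants where
  toFun r := ∑ n : N.divisors, r n • invVec N n
  map_zero' := by simp
  map_add' r s := by simp [add_smul, Finset.sum_add_distrib]

theorem invariant_apply {N : ℕ} (r : Exponents N) :
    invariant N r = ∑ n : N.divisors, r n • invVec N n := rfl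

theorem intCast_eq_zero_iff_even (k : ℤ) : (k : ZMod 2) = 0 ↔ Even k := by
  rw [ZMod.intCast_zmod_eq_zero_iff_dvd, even_iff_two_dvd]
  rfl

/-- In `ZMod 2` an integral combination is the sum of the terms with odd coefficient. -/
theorem sum_mul_eq_sum_odd {ι : Type*} (s : Finset ι) (k : ι → ℤ) (f : ι → ℕ)
    [DecidablePred fun i => Odd (k i)] :
    ∑ i ∈ s, (k i : ZMod 2) * f i = ((∑ i ∈ s with Odd (k i), f i : ℕ) : ZMod 2) := by
  rw [Finset.sum_filter, Nat.cast_sum]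
  refine Finset.sum_congr rfl fun i _ => ?_
  split_ifs with h
  · rw [(ZMod.intCast_eq_one_iff_odd).mpr h, one_mul]
  · rw [(intCast_eq_zero_iff_even _).mpr (Int.not_odd_iff_even.mp h), zero_mul, Nat.cast_zero]

theorem isSquare_oddPart_iff {N : ℕ} (r : Exponents N) :
    IsSquare (oddPart r) ↔
      ∀ p, ∑ n : N.divisors, (r n : ZMod 2) * ((n : ℕ).factorization p : ℕ) = 0 := by
  rw [isSquare_iff_even_factorization (oddPart_pos r).ne']
  have h : ∀ p, ∑ n : N.divisors, (r n : ZMod 2) * ((n : ℕ).factorization p : ℕ) = 0 ↔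
      Even ((oddPart r).factorization p) := fun p => by
    rw [sum_mul_eq_sum_odd, oddPart, Nat.factorization_prod fun n _ => (divisor_pos n).ne',
      Finsupp.finsetSum_apply, ZMod.natCast_eq_zero_iff_even]
  simp only [h]
  refine ⟨fun h p => ?_, fun h p _ => h p⟩
  by_cases hp : p.Prime
  · exact h p hp
  · rw [Nat.factorization_eq_zero_of_not_prime _ hp]
    exact Even.zero

/-- As Σ r_n = 0, the constants 1 and N subtracted in `invVec` drop out. The last component records
the parities of the valuations of `oddPart r`. -/
theorem mem_Z_iff {N : ℕ} {r : Exponents N} (hr : ∑ n, r n = 0) :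
    r ∈ Z N ↔ invariant N r = 0 := by
  have h1 : (invariant N r).1 = ((∑ n : N.divisors, ((n : ℕ) : ℤ) * r n : ℤ) : ZMod 24) := by
    have hr' := congrArg (fun z : ℤ => (z : ZMod 24)) hr
    push_cast at hr' ⊢
    rw [invariant_apply, Prod.fst_sum, ← sub_zero (∑ n : N.divisors, _ * _), ← hr',
      ← Finset.sum_sub_distrib]
    refine Finset.sum_congr rfl fun n _ => ?_
    simp [invVec]
    ring
  have h2 : (invariant N r).2.1
      = ((∑ n : N.divisors, ((N / (n : ℕ) : ℕ) : ℤ) * r n : ℤ) : ZMod 24) := by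
    have hr' := congrArg (fun z : ℤ => (N : ZMod 24) * (z : ZMod 24)) hr
    simp only [Int.cast_sum, Int.cast_zero, mul_zero] at hr'
    rw [invariant_apply, Prod.snd_sum, Prod.fst_sum, Int.cast_sum, eq_comm, ← sub_eq_zero,
      ← hr', Finset.mul_sum, ← Finset.sum_sub_distrib]
    refine Finset.sum_congr rfl fun n _ => ?_
    rw [Int.cast_mul, Int.cast_natCast]
    simp only [invVec, Prod.smul_mk]
    rw [zsmul_eq_mul]
    ring
  have h3 : ∀ p, (invariant N r).2.2 p
      = ∑ n : N.divisors, (r n : ZMod 2) * ((n : ℕ).factorization p : ℕ) := fun p => by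
    rw [invariant_apply, Prod.snd_sum, Prod.snd_sum, Finset.sum_apply]
    refine Finset.sum_congr rfl fun n _ => ?_
    simp [invVec]
  rw [Prod.ext_iff, Prod.ext_iff, funext_iff, h1, h2]
  simp only [h3, Prod.fst_zero, Prod.snd_zero, Pi.zero_apply]
  rw [← isSquare_oddPart_iff, ZMod.intCast_zmod_eq_zero_iff_dvd, ZMod.intCast_zmod_eq_zero_iff_dvd]
  exact ⟨fun h => h.2, fun h => ⟨hr, h⟩⟩

theorem exists_prime_pow_of_mem_indexSet {N n : ℕ} (h : n ∈ indexSet N) :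
    ∃ q k, q.Prime ∧ 1 ≤ k ∧ k ≤ N.factorization q ∧ n = q ^ k := by
  rw [indexSet, Finset.mem_biUnion] at h
  obtain ⟨q, hq, h⟩ := h
  have hqp := Nat.prime_of_mem_primeFactors hq
  have hpos : 0 < N.factorization q := hqp.factorization_pos_of_dvd
    (Nat.mem_primeFactors.mp hq).2.2 (Nat.dvd_of_mem_primeFactors hq)
  rw [indexSetAt] at h
  split_ifs at h with h2 ha hb h3 ha
  · subst h2
    exact ⟨2, 1, hqp, le_rfl, ha.ge, by simpa using h⟩
  · subst h2
    rcases Finset.mem_insert.mp h with h | h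
    · exact ⟨2, 1, hqp, le_rfl, by omega, by simpa using h⟩
    · exact ⟨2, 2, hqp, by omega, by omega, by simpa using h⟩
  · subst h2
    simp only [Finset.mem_insert, Finset.mem_singleton] at h
    rcases h with h | h | h
    · exact ⟨2, _, hqp, by omega, by omega, h⟩
    · exact ⟨2, _, hqp, by omega, by omega, h⟩
    · exact ⟨2, _, hqp, by omega, by omega, h⟩
  · subst h3
    exact ⟨3, 1, hqp, le_rfl, ha.ge, by simpa using h⟩
  · subst h3
    simp only [Finset.mem_insert, Finset.mem_singleton] at h
    rcases h with h | h
    · exact ⟨3, _, hqp, by omega, by omega, h⟩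
    · exact ⟨3, _, hqp, by omega, by omega, h⟩
  · exact ⟨q, 1, hqp, le_rfl, hpos, by simpa using h⟩

theorem dvd_of_mem_indexSet {N n : ℕ} (h : n ∈ indexSet N) : n ∣ N := by
  obtain ⟨q, k, -, -, hk, rfl⟩ := exists_prime_pow_of_mem_indexSet h
  exact (pow_dvd_pow q hk).trans (Nat.ordProj_dvd N q)

theorem prime_mem_indexSet {N p : ℕ} (hp : p ∈ N.primeFactors) (h2 : p ≠ 2) (h3 : p ≠ 3) :
    p ∈ indexSet N :=
  Finset.mem_biUnion.mpr ⟨p, hp, by simp [indexSetAt, h2, h3]⟩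

theorem eq_prime_of_mem_indexSet {N n p : ℕ} (hp : p.Prime) (h2 : p ≠ 2) (h3 : p ≠ 3)
    (hn : n ∈ indexSet N) (hpn : p ∣ n) : n = p := by
  rw [indexSet, Finset.mem_biUnion] at hn
  obtain ⟨q, hq, h⟩ := hn
  have hqp := Nat.prime_of_mem_primeFactors hq
  have key : ∀ k, n = q ^ k → p = q := fun k hk =>
    (Nat.prime_dvd_prime_iff_eq hp hqp).mp (hp.dvd_of_dvd_pow (hk ▸ hpn))
  by_cases hq2 : q = 2
  · subst hq2
    exfalso
    apply h2
    simp only [indexSetAt, if_true] at h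
    split_ifs at h
    · exact key 1 (by simpa using h)
    · rcases Finset.mem_insert.mp h with h | h
      · exact key 1 (by simpa using h)
      · exact key 2 (by simpa using h)
    · simp only [Finset.mem_insert, Finset.mem_singleton] at h
      rcases h with h | h | h <;> exact key _ h
  by_cases hq3 : q = 3
  · subst hq3
    exfalso
    apply h3
    simp only [indexSetAt, if_true, show (3 : ℕ) ≠ 2 by norm_num, if_false] at h
    split_ifs at h
    · exact key 1 (by simpa using h)
    · simp only [Finset.mem_insert, Finset.mem_singleton] at h
      rcases h with h | h <;> exact key _ h
  · simp only [indexSetAt, hq2, hq3, if_false, Finset.mem_singleton] at h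
    rw [h]
    exact (key 1 (by simpa using h)).symm

theorem sum_indexSet_factorization {N p : ℕ} (hp : p.Prime) (c : ℕ → ℤ) :
    ∑ n ∈ indexSet N, (c n : ZMod 2) * (n.factorization p : ℕ) =
      ∑ β ∈ Finset.range (N.factorization p + 1) with p ^ β ∈ indexSet N,
        (c (p ^ β) : ZMod 2) * (β : ℕ) := by
  have himg : ∑ β ∈ Finset.range (N.factorization p + 1) with p ^ β ∈ indexSet N,
        (c (p ^ β) : ZMod 2) * (β : ℕ) =
      ∑ n ∈ (Finset.range (N.factorization p + 1) |>.filter fun β => p ^ β ∈ indexSet N).image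
        (p ^ ·), (c n : ZMod 2) * (n.factorization p : ℕ) := by
    rw [Finset.sum_image fun a _ b _ h => Nat.pow_right_injective hp.two_le h]
    refine Finset.sum_congr rfl fun β _ => ?_
    rw [hp.factorization_pow, Finsupp.single_eq_same]
  rw [himg]
  symm
  refine Finset.sum_subset (fun n hn => ?_) fun n hn hn' => ?_
  · obtain ⟨β, hβ, rfl⟩ := Finset.mem_image.mp hn
    exact (Finset.mem_filter.mp hβ).2
  · obtain ⟨q, k, hq, -, hk, rfl⟩ := exists_prime_pow_of_mem_indexSet hn
    rcases eq_or_ne q p with rfl | hqp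
    · exact absurd (Finset.mem_image.mpr ⟨k, Finset.mem_filter.mpr
        ⟨Finset.mem_range.mpr (by omega), hn⟩, rfl⟩) hn'
    · rw [hq.factorization_pow, Finsupp.single_eq_of_ne hqp.symm, Nat.cast_zero, mul_zero]

theorem sum_indexSet_eq_zero_iff {N p : ℕ} (hp : p.Prime) (c : ℕ → ℤ) :
    ∑ n ∈ indexSet N, (c n : ZMod 2) * (n.factorization p : ℕ) = 0 ↔
      Even (∑ β ∈ Finset.range (N.factorization p + 1) with
        p ^ β ∈ indexSet N ∧ Odd (c (p ^ β)), β) := by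
  rw [sum_indexSet_factorization hp, sum_mul_eq_sum_odd _ (fun β => c (p ^ β)) fun β => β,
    Finset.filter_filter, ZMod.natCast_eq_zero_iff_even]

/-- A prime p ≥ 5 dividing N divides only one element of the index set, p itself, so its parity
component is c_p. Primes not dividing N contribute nothing. -/
theorem congruenceSystem_iff {N : ℕ} (c : ℕ → ℤ) :
    CongruenceSystem N c ↔ ∑ n ∈ indexSet N, c n • invVec N n = 0 := by
  have h1 : (∑ n ∈ indexSet N, c n • invVec N n).1
      = ((∑ n ∈ indexSet N, ((n : ℤ) - 1) * c n : ℤ) : ZMod 24) := by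
    rw [Prod.fst_sum, Int.cast_sum]
    refine Finset.sum_congr rfl fun n _ => ?_
    simp [invVec]
    ring
  have h2 : (∑ n ∈ indexSet N, c n • invVec N n).2.1
      = ((∑ n ∈ indexSet N, (((N / n : ℕ) : ℤ) - (N : ℤ)) * c n : ℤ) : ZMod 24) := by
    rw [Prod.snd_sum, Prod.fst_sum, Int.cast_sum]
    refine Finset.sum_congr rfl fun n _ => ?_
    rw [Int.cast_mul, Int.cast_sub, Int.cast_natCast, Int.cast_natCast]
    simp only [invVec, Prod.smul_mk]
    rw [zsmul_eq_mul]
    ring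
  have h3 : ∀ p, (∑ n ∈ indexSet N, c n • invVec N n).2.2 p
      = ∑ n ∈ indexSet N, (c n : ZMod 2) * (n.factorization p : ℕ) := fun p => by
    rw [Prod.snd_sum, Prod.snd_sum, Finset.sum_apply]
    refine Finset.sum_congr rfl fun n _ => ?_
    simp [invVec]
  have hlarge : ∀ p, p ∈ N.primeFactors → p ≠ 2 → p ≠ 3 →
      (∑ n ∈ indexSet N, (c n : ZMod 2) * (n.factorization p : ℕ) = 0 ↔ Even (c p)) := by
    intro p hp hp2 hp3
    have hpp := Nat.prime_of_mem_primeFactors hp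
    rw [Finset.sum_eq_single_of_mem p (prime_mem_indexSet hp hp2 hp3), hpp.factorization_self,
      Nat.cast_one, mul_one, intCast_eq_zero_iff_even]
    intro n hn hnp
    rw [Nat.factorization_eq_zero_of_not_dvd
      fun hd => hnp (eq_prime_of_mem_indexSet hpp hp2 hp3 hn hd), Nat.cast_zero, mul_zero]
  rw [Prod.ext_iff, Prod.ext_iff, funext_iff, h1, h2, CongruenceSystem]
  simp only [h3, Prod.fst_zero, Prod.snd_zero, Pi.zero_apply]
  rw [ZMod.intCast_zmod_eq_zero_iff_dvd, ZMod.intCast_zmod_eq_zero_iff_dvd,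
    ← sum_indexSet_eq_zero_iff Nat.prime_two, ← sum_indexSet_eq_zero_iff Nat.prime_three]
  refine and_congr Iff.rfl (and_congr Iff.rfl ⟨?_, ?_⟩)
  · rintro ⟨hl, e2, e3⟩ p
    by_cases hpN : p ∈ N.primeFactors
    · by_cases hp2 : p = 2
      · rw [hp2]; exact e2
      by_cases hp3 : p = 3
      · rw [hp3]; exact e3
      exact (hlarge p hpN hp2 hp3).mpr (hl p hpN hp2 hp3)
    · refine Finset.sum_eq_zero fun n hn => ?_
      have hN : n.factorization p = 0 := by
        obtain ⟨q, k, hq, hk1, hk, rfl⟩ := exists_prime_pow_of_mem_indexSet hn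
        have hqN : q ∈ N.primeFactors := by
          rw [← Nat.support_factorization, Finsupp.mem_support_iff]
          omega
        rw [hq.factorization_pow, Finsupp.single_eq_of_ne]
        rintro rfl
        exact hpN hqN
      rw [hN, Nat.cast_zero, mul_zero]
  · intro h
    exact ⟨fun p hp hp2 hp3 => (hlarge p hp hp2 hp3).mp (h p), h 2, h 3⟩

end EtaChar

end

noncomputable section

namespace EtaChar

/-! ### Relations between the invariants -/

theorem invariants_ext {g h : Invariants} (h1 : g.1 = h.1) (h2 : g.2.1 = h.2.1)
    (h3 : ∀ p, g.2.2 p = h.2.2 p) : g = h :=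
  Prod.ext h1 (Prod.ext h2 (funext h3))

theorem zsmul_invVec_fst (N n : ℕ) (e : ℤ) :
    (e • invVec N n).1 = (e : ZMod 24) * ((n : ZMod 24) - 1) := by
  rw [← zsmul_eq_mul]; rfl

theorem zsmul_invVec_snd_fst (N n : ℕ) (e : ℤ) :
    (e • invVec N n).2.1 = (e : ZMod 24) * (((N / n : ℕ) : ZMod 24) - N) := by
  rw [← zsmul_eq_mul]; rfl

theorem zsmul_invVec_snd_snd (N n : ℕ) (e : ℤ) (p : ℕ) :
    (e • invVec N n).2.2 p = (e : ZMod 2) * (n.factorization p : ℕ) := by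
  rw [← zsmul_eq_mul]; rfl

theorem invariants_add_fst (g h : Invariants) : (g + h).1 = g.1 + h.1 := rfl
theorem invariants_add_snd_fst (g h : Invariants) : (g + h).2.1 = g.2.1 + h.2.1 := rfl
theorem invariants_add_snd_snd (g h : Invariants) (p : ℕ) :
    (g + h).2.2 p = g.2.2 p + h.2.2 p := rfl

/-- A twisted additivity of `invVec`. -/
theorem zsmul_invVec_mul {m n k : ℕ} (hm : 0 < m) (hn : 0 < n) (e : ℤ)
    (h24 : (e : ZMod 24) * (1 - (m : ZMod 24) ^ 2) = 0)
    (h2 : (e : ZMod 2) * ((m : ZMod 2) - 1) = 0) :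
    e • invVec (m * n * k) (m * n)
      = e • invVec (m * n * k) m + (e * m) • invVec (m * n * k) n := by
  have d1 : m * n * k / (m * n) = k := Nat.mul_div_cancel_left k (Nat.mul_pos hm hn)
  have d2 : m * n * k / m = n * k := by rw [mul_assoc, Nat.mul_div_cancel_left _ hm]
  have d3 : m * n * k / n = m * k := by
    rw [mul_comm m n, mul_assoc, Nat.mul_div_cancel_left _ hn]
  refine invariants_ext ?_ ?_ fun p => ?_
  · rw [invariants_add_fst, zsmul_invVec_fst, zsmul_invVec_fst, zsmul_invVec_fst]
    push_cast
    ring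
  · rw [invariants_add_snd_fst, zsmul_invVec_snd_fst, zsmul_invVec_snd_fst, zsmul_invVec_snd_fst,
      d1, d2, d3]
    push_cast
    -- The two sides differ by e · k(1 - n)(1 - m²).
    linear_combination ((k : ZMod 24) - n * k) * h24
  · rw [invariants_add_snd_snd, zsmul_invVec_snd_snd, zsmul_invVec_snd_snd, zsmul_invVec_snd_snd,
      Nat.factorization_mul hm.ne' hn.ne', Finsupp.add_apply]
    push_cast
    linear_combination (-(n.factorization p : ZMod 2)) * h2

/-- The coefficient 9 kills everything modulo 3; modulo 8 the factor 9 is 1, and being a square it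
preserves parities. -/
theorem nine_smul_invVec_nine_mul {n k : ℕ} (hn : 0 < n) :
    (9 : ℤ) • invVec (9 * n * k) (9 * n) = (9 : ℤ) • invVec (9 * n * k) n := by
  have d1 : 9 * n * k / (9 * n) = k := Nat.mul_div_cancel_left k (by omega)
  have d3 : 9 * n * k / n = 9 * k := by
    rw [mul_comm 9 n, mul_assoc, Nat.mul_div_cancel_left _ hn]
  have h72 : (72 : ZMod 24) = 0 := by decide
  have h2 : (2 : ZMod 2) = 0 := by decide
  refine invariants_ext ?_ ?_ fun p => ?_
  · rw [zsmul_invVec_fst, zsmul_invVec_fst]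
    push_cast
    linear_combination (n : ZMod 24) * h72
  · rw [zsmul_invVec_snd_fst, zsmul_invVec_snd_fst, d1, d3]
    push_cast
    linear_combination (-(k : ZMod 24)) * h72
  · rw [zsmul_invVec_snd_snd, zsmul_invVec_snd_snd, show 9 * n = 3 ^ 2 * n by norm_num,
      Nat.factorization_mul (by norm_num) hn.ne', Nat.factorization_pow, Finsupp.add_apply,
      Finsupp.smul_apply]
    push_cast [smul_eq_mul]
    linear_combination (9 * (Nat.factorization 3 p : ZMod 2)) * h2

/-- The coefficient 16 kills everything modulo 8 and all parities; modulo 3 the factor 4 is 1. -/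
theorem sixteen_smul_invVec_four_mul {n k : ℕ} (hn : 0 < n) :
    (16 : ℤ) • invVec (4 * n * k) (4 * n) = (16 : ℤ) • invVec (4 * n * k) n := by
  have d1 : 4 * n * k / (4 * n) = k := Nat.mul_div_cancel_left k (by omega)
  have d3 : 4 * n * k / n = 4 * k := by
    rw [mul_comm 4 n, mul_assoc, Nat.mul_div_cancel_left _ hn]
  have h48 : (48 : ZMod 24) = 0 := by decide
  have h16 : ((16 : ℤ) : ZMod 2) = 0 := by decide
  refine invariants_ext ?_ ?_ fun p => ?_
  · rw [zsmul_invVec_fst, zsmul_invVec_fst]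
    push_cast
    linear_combination (n : ZMod 24) * h48
  · rw [zsmul_invVec_snd_fst, zsmul_invVec_snd_fst, d1, d3]
    push_cast
    linear_combination (-(k : ZMod 24)) * h48
  · rw [zsmul_invVec_snd_snd, zsmul_invVec_snd_snd, h16, zero_mul, zero_mul]

theorem nine_smul_invVec_pow {N a : ℕ} (h : 3 ^ a ∣ N) :
    ∀ i j, i ≤ a → j ≤ a → i % 2 = j % 2 →
      (9 : ℤ) • invVec N (3 ^ i) = (9 : ℤ) • invVec N (3 ^ j) := by
  have base : ∀ i, i ≤ a → (9 : ℤ) • invVec N (3 ^ i) = (9 : ℤ) • invVec N (3 ^ (i % 2)) := by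
    intro i
    induction i using Nat.strong_induction_on with
    | _ i ih =>
      intro hi
      rcases Nat.lt_or_ge i 2 with h2 | h2
      · rw [Nat.mod_eq_of_lt h2]
      obtain ⟨l, rfl⟩ := Nat.exists_eq_add_of_le' h2
      obtain ⟨k, hk⟩ := (pow_dvd_pow 3 hi).trans h
      have hk' : N = 9 * 3 ^ l * k := by rw [hk]; ring
      have hp : 3 ^ (l + 2) = 9 * 3 ^ l := by ring
      rw [hp, hk', nine_smul_invVec_nine_mul (by positivity), ← hk', ih l (by omega) (by omega),
        Nat.add_mod_right]
  intro i j hi hj hij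
  rw [base i hi, base j hj, hij]

theorem sixteen_smul_invVec_pow {N a : ℕ} (h : 2 ^ a ∣ N) :
    ∀ i j, i ≤ a → j ≤ a → i % 2 = j % 2 →
      (16 : ℤ) • invVec N (2 ^ i) = (16 : ℤ) • invVec N (2 ^ j) := by
  have base : ∀ i, i ≤ a → (16 : ℤ) • invVec N (2 ^ i) = (16 : ℤ) • invVec N (2 ^ (i % 2)) := by
    intro i
    induction i using Nat.strong_induction_on with
    | _ i ih =>
      intro hi
      rcases Nat.lt_or_ge i 2 with h2 | h2
      · rw [Nat.mod_eq_of_lt h2]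
      obtain ⟨l, rfl⟩ := Nat.exists_eq_add_of_le' h2
      obtain ⟨k, hk⟩ := (pow_dvd_pow 2 hi).trans h
      have hk' : N = 4 * 2 ^ l * k := by rw [hk]; ring
      have hp : 2 ^ (l + 2) = 4 * 2 ^ l := by ring
      rw [hp, hk', sixteen_smul_invVec_four_mul (by positivity), ← hk',
        ih l (by omega) (by omega), Nat.add_mod_right]
  intro i j hi hj hij
  rw [base i hi, base j hj, hij]

/-- Here 3 divides both 3^i and N/3^i, so modulo 3 only the constants -1 and -N survive, and they do
not depend on i. -/
theorem sixteen_smul_invVec_three_pow {N i j : ℕ} (hi : 1 ≤ i) (hj : 1 ≤ j)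
    (hi' : 3 ^ (i + 1) ∣ N) (hj' : 3 ^ (j + 1) ∣ N) :
    (16 : ℤ) • invVec N (3 ^ i) = (16 : ℤ) • invVec N (3 ^ j) := by
  have h48 : (48 : ZMod 24) = 0 := by decide
  have h16 : ((16 : ℤ) : ZMod 2) = 0 := by decide
  have key1 : ∀ i, 1 ≤ i → (((16 : ℤ) : ZMod 24)) * ((3 ^ i : ℕ) : ZMod 24) = 0 := by
    intro i hi
    obtain ⟨l, rfl⟩ := Nat.exists_eq_add_of_le' hi
    push_cast
    linear_combination (3 : ZMod 24) ^ l * h48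
  have key2 : ∀ i, 3 ^ (i + 1) ∣ N → ((16 : ℤ) : ZMod 24) * ((N / 3 ^ i : ℕ) : ZMod 24) = 0 := by
    rintro i ⟨k, rfl⟩
    rw [pow_succ, mul_assoc, Nat.mul_div_cancel_left _ (by positivity)]
    push_cast
    linear_combination (k : ZMod 24) * h48
  refine invariants_ext ?_ ?_ fun p => ?_
  · rw [zsmul_invVec_fst, zsmul_invVec_fst, mul_sub, mul_sub, key1 i hi, key1 j hj]
  · rw [zsmul_invVec_snd_fst, zsmul_invVec_snd_fst, mul_sub, mul_sub, key2 i hi', key2 j hj']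
  · rw [zsmul_invVec_snd_snd, zsmul_invVec_snd_snd, h16, zero_mul, zero_mul]

/-- For `8 ∣ N` the three highest powers of `2` span the whole `2`-part attached to the first
invariant and the exponent of `2`. -/
theorem nine_smul_mem {l M : ℕ} {H : AddSubgroup Invariants}
    (hA : invVec (2 ^ (l + 3) * M) (2 ^ (l + 1)) ∈ H)
    (hB : invVec (2 ^ (l + 3) * M) (2 ^ (l + 2)) ∈ H)
    (hC : invVec (2 ^ (l + 3) * M) (2 ^ (l + 3)) ∈ H) (t z : ℤ) :
    ((9 * t, 0, Pi.single 2 (z : ZMod 2)) : ZMod 24 × ZMod 24 × (ℕ → ZMod 2)) ∈ H := by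
  -- Let A, B, C be the three given invariants, with N/n equal to 4M, 2M, M. The combination xA + yB
  -- - (4x + 2y)C has second component 0 modulo 8 and no parity from C. Modulo 8 the first
  -- components of A - 4C and B - 2C are 2·2^l + 3 and 4·2^l + 1, odd and so self-inverse. A carries
  -- the odd parity for even l and B for odd l; that coefficient is z, and the other solves the
  -- first component.
  obtain ⟨x, y, hxy, hz⟩ : ∃ x y : ℤ,
      (9 * (x * (2 * 2 ^ l + 3) + y * (4 * 2 ^ l + 1)) : ZMod 24) = 9 * t ∧
      ((x * (l + 1) + y * l : ℤ) : ZMod 2) = z := by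
    have h24 : ∀ w : ZMod 24, 9 * (2 * w + 3) ^ 2 = 9 := by decide
    have h24' : ∀ w : ZMod 24, 9 * (4 * w + 1) ^ 2 = 9 := by decide
    rcases Nat.even_or_odd l with hl | hl
    · refine ⟨z, (4 * 2 ^ l + 1) * (t - z * (2 * 2 ^ l + 3)), ?_, ?_⟩
      · push_cast
        linear_combination (t - z * (2 * 2 ^ l + 3) : ZMod 24) * h24' (2 ^ l)
      · have : (l : ZMod 2) = 0 := (ZMod.natCast_eq_zero_iff_even).mpr hl
        push_cast
        rw [this]
        ring
    · refine ⟨(2 * 2 ^ l + 3) * (t - z * (4 * 2 ^ l + 1)), z, ?_, ?_⟩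
      · push_cast
        linear_combination (t - z * (4 * 2 ^ l + 1) : ZMod 24) * h24 (2 ^ l)
      · have : (l : ZMod 2) = 1 := (ZMod.natCast_eq_one_iff_odd).mpr hl
        have h2 : (2 : ZMod 2) = 0 := by decide
        push_cast
        rw [this]
        linear_combination ((2 * 2 ^ l + 3) * (t - z * (4 * 2 ^ l + 1)) : ZMod 2) * h2
  have h72 : (72 : ZMod 24) = 0 := by decide
  have h2 : (2 : ZMod 2) = 0 := by decide
  have dA : 2 ^ (l + 3) * M / 2 ^ (l + 1) = 4 * M := by
    rw [show 2 ^ (l + 3) * M = 2 ^ (l + 1) * (4 * M) by ring,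
      Nat.mul_div_cancel_left _ (by positivity)]
  have dB : 2 ^ (l + 3) * M / 2 ^ (l + 2) = 2 * M := by
    rw [show 2 ^ (l + 3) * M = 2 ^ (l + 2) * (2 * M) by ring,
      Nat.mul_div_cancel_left _ (by positivity)]
  have dC : 2 ^ (l + 3) * M / 2 ^ (l + 3) = M := Nat.mul_div_cancel_left _ (by positivity)
  have hmem := H.add_mem (H.add_mem (H.zsmul_mem hA (9 * x)) (H.zsmul_mem hB (9 * y)))
    (H.zsmul_mem hC (9 * (-4 * x - 2 * y)))
  convert hmem using 1
  refine invariants_ext ?_ ?_ fun p => ?_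
  · rw [invariants_add_fst, invariants_add_fst, zsmul_invVec_fst, zsmul_invVec_fst,
      zsmul_invVec_fst]
    push_cast
    rw [← hxy]
    linear_combination (4 * x * 2 ^ l + 2 * y * 2 ^ l : ZMod 24) * h72
  · rw [invariants_add_snd_fst, invariants_add_snd_fst, zsmul_invVec_snd_fst,
      zsmul_invVec_snd_fst, zsmul_invVec_snd_fst, dA, dB, dC]
    push_cast
    linear_combination ((x + y + (-4 * x - 2 * y)) * 2 ^ l * M : ZMod 24) * h72
  · rw [invariants_add_snd_snd, invariants_add_snd_snd, zsmul_invVec_snd_snd,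
      zsmul_invVec_snd_snd, zsmul_invVec_snd_snd]
    simp only [Nat.prime_two.factorization_pow]
    rcases eq_or_ne p 2 with rfl | hp
    · simp only [Finsupp.single_eq_same, Pi.single_eq_same]
      rw [← hz]
      push_cast
      linear_combination (-(4 * x * (l + 1) + 4 * y * l + 9 * y
        + 9 * (-2 * x - y) * (l + 3)) : ZMod 2) * h2
    · simp [Finsupp.single_eq_of_ne hp, hp]

end EtaChar

end

noncomputable section

namespace EtaChar

/-! ### The index set spans -/

/-- 9 + 16 ≡ 1 mod 24, so membership may be tested on the parts modulo 8 (with parities) and modulo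
3 separately. -/
theorem mem_of_nine_smul_mem {H : AddSubgroup Invariants} {g : Invariants}
    (h9 : (9 : ℤ) • g ∈ H) (h16 : (16 : ℤ) • g ∈ H) : g ∈ H := by
  have h : g = (9 : ℤ) • g + (16 : ℤ) • g - (24 : ℤ) • g := by
    rw [← add_smul, ← sub_smul]
    norm_num
  rw [h, invariants_torsion, sub_zero]
  exact H.add_mem h9 h16

/-- Both N/2^β and N are multiples of 8, so 9 kills the second component. What is left has the form
supplied by `nine_smul_mem`. -/
theorem nine_smul_invVec_two_pow {N β : ℕ} (h : 2 ^ (β + 3) ∣ N) :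
    (9 : ℤ) • invVec N (2 ^ β) =
      ((9 * ((2 ^ β - 1 : ℤ) : ZMod 24), 0, Pi.single 2 ((β : ℤ) : ZMod 2)) :
        ZMod 24 × ZMod 24 × (ℕ → ZMod 2)) := by
  obtain ⟨k, rfl⟩ := h
  have d : 2 ^ (β + 3) * k / 2 ^ β = 8 * k := by
    rw [show 2 ^ (β + 3) * k = 2 ^ β * (8 * k) by ring, Nat.mul_div_cancel_left _ (by positivity)]
  have h72 : (72 : ZMod 24) = 0 := by decide
  have h9 : ((9 : ℤ) : ZMod 2) = 1 := by decide
  refine invariants_ext ?_ ?_ fun p => ?_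
  · rw [zsmul_invVec_fst]
    push_cast
    ring
  · rw [zsmul_invVec_snd_fst, d]
    push_cast
    linear_combination ((k : ZMod 24) - 2 ^ β * k) * h72
  · rw [zsmul_invVec_snd_snd, h9, one_mul, Nat.prime_two.factorization_pow]
    rcases eq_or_ne p 2 with rfl | hp
    · simp
    · simp [Finsupp.single_eq_of_ne hp, hp]

theorem two_pow_mem_indexSet {N i : ℕ} (h1 : 1 ≤ i) (h : i ≤ N.factorization 2)
    (h2 : N.factorization 2 ≤ i + 2) : 2 ^ i ∈ indexSet N := by
  have hp : 2 ∈ N.primeFactors := by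
    rw [← Nat.support_factorization, Finsupp.mem_support_iff]
    omega
  refine Finset.mem_biUnion.mpr ⟨2, hp, ?_⟩
  rw [indexSetAt, if_pos rfl]
  split_ifs with ha hb
  · rw [show i = 1 by omega]
    simp
  · obtain rfl | rfl : i = 1 ∨ i = 2 := by omega
    · simp
    · simp
  · simp only [Finset.mem_insert, Finset.mem_singleton]
    obtain h' | h' | h' : i = N.factorization 2 - 2 ∨ i = N.factorization 2 - 1 ∨
      i = N.factorization 2 := by omega
    · exact Or.inl (congrArg _ h')
    · exact Or.inr (Or.inl (congrArg _ h'))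
    · exact Or.inr (Or.inr (congrArg _ h'))

theorem three_pow_mem_indexSet {N i : ℕ} (h1 : 1 ≤ i) (h : i ≤ N.factorization 3)
    (h2 : N.factorization 3 ≤ i + 1) : 3 ^ i ∈ indexSet N := by
  have hp : 3 ∈ N.primeFactors := by
    rw [← Nat.support_factorization, Finsupp.mem_support_iff]
    omega
  refine Finset.mem_biUnion.mpr ⟨3, hp, ?_⟩
  rw [indexSetAt, if_neg (by norm_num), if_pos rfl]
  split_ifs with ha
  · rw [show i = 1 by omega]
    simp
  · simp only [Finset.mem_insert, Finset.mem_singleton]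
    obtain h' | h' : i = N.factorization 3 - 1 ∨ i = N.factorization 3 := by omega
    · exact Or.inl (congrArg _ h')
    · exact Or.inr (congrArg _ h')

theorem invVec_two_pow_mem {N : ℕ} {H : AddSubgroup Invariants}
    (hH : ∀ b ∈ indexSet N, invVec N b ∈ H) {β : ℕ} (hβ : β ≤ N.factorization 2) :
    invVec N (2 ^ β) ∈ H := by
  rcases Nat.eq_zero_or_pos β with rfl | hβ0
  · rw [pow_zero, invVec_one]
    exact H.zero_mem
  by_cases hβ2 : N.factorization 2 ≤ β + 2
  · exact hH _ (two_pow_mem_indexSet hβ0 hβ hβ2)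
  have hdvd : 2 ^ N.factorization 2 ∣ N := Nat.ordProj_dvd N 2
  refine mem_of_nine_smul_mem ?_ ?_
  · obtain ⟨l, hl⟩ : ∃ l, N.factorization 2 = l + 3 := ⟨N.factorization 2 - 3, by omega⟩
    rw [nine_smul_invVec_two_pow ((pow_dvd_pow 2 (by omega)).trans hdvd)]
    have hA := hH _ (two_pow_mem_indexSet (N := N) (i := l + 1) (by omega) (by omega) (by omega))
    have hB := hH _ (two_pow_mem_indexSet (N := N) (i := l + 2) (by omega) (by omega) (by omega))
    have hC := hH _ (two_pow_mem_indexSet (N := N) (i := l + 3) (by omega) (by omega) (by omega))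
    obtain ⟨M, hM⟩ := hdvd
    rw [hl] at hM
    rw [hM] at hA hB hC
    exact nine_smul_mem hA hB hC _ _
  -- The part modulo 3 depends only on the parity of β: odd β is compared with an odd exponent in
  -- the index set, even β with exponent 0, whose invariant vanishes.
  · obtain ⟨i, hi1, hi, hi2, hodd⟩ : ∃ i, 1 ≤ i ∧ i ≤ N.factorization 2 ∧
        N.factorization 2 ≤ i + 2 ∧ i % 2 = 1 := by
      by_cases h : N.factorization 2 % 2 = 1
      · exact ⟨N.factorization 2, by omega, by omega, by omega, h⟩
      · exact ⟨N.factorization 2 - 1, by omega, by omega, by omega, by omega⟩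
    by_cases hpar : β % 2 = 1
    · rw [sixteen_smul_invVec_pow hdvd β i hβ hi (by omega)]
      exact H.zsmul_mem (hH _ (two_pow_mem_indexSet hi1 hi hi2)) _
    · rw [sixteen_smul_invVec_pow hdvd β 0 hβ (by omega) (by omega), pow_zero, invVec_one,
        smul_zero]
      exact H.zero_mem

theorem invVec_three_pow_mem {N : ℕ} {H : AddSubgroup Invariants}
    (hH : ∀ b ∈ indexSet N, invVec N b ∈ H) {β : ℕ} (hβ : β ≤ N.factorization 3) :
    invVec N (3 ^ β) ∈ H := by
  rcases Nat.eq_zero_or_pos β with rfl | hβ0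
  · rw [pow_zero, invVec_one]
    exact H.zero_mem
  by_cases hβ2 : N.factorization 3 ≤ β + 1
  · exact hH _ (three_pow_mem_indexSet hβ0 hβ hβ2)
  have hdvd : 3 ^ N.factorization 3 ∣ N := Nat.ordProj_dvd N 3
  refine mem_of_nine_smul_mem ?_ ?_
  · obtain ⟨i, hi1, hi, hi2, hodd⟩ : ∃ i, 1 ≤ i ∧ i ≤ N.factorization 3 ∧
        N.factorization 3 ≤ i + 1 ∧ i % 2 = 1 := by
      by_cases h : N.factorization 3 % 2 = 1
      · exact ⟨N.factorization 3, by omega, by omega, by omega, h⟩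
      · exact ⟨N.factorization 3 - 1, by omega, by omega, by omega, by omega⟩
    by_cases hpar : β % 2 = 1
    · rw [nine_smul_invVec_pow hdvd β i hβ hi (by omega)]
      exact H.zsmul_mem (hH _ (three_pow_mem_indexSet hi1 hi hi2)) _
    · rw [nine_smul_invVec_pow hdvd β 0 hβ (by omega) (by omega), pow_zero, invVec_one,
        smul_zero]
      exact H.zero_mem
  · rw [sixteen_smul_invVec_three_pow (j := N.factorization 3 - 1) hβ0 (by omega)
      ((pow_dvd_pow 3 (by omega)).trans hdvd) ((pow_dvd_pow 3 (by omega)).trans hdvd)]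
    exact H.zsmul_mem (hH _ (three_pow_mem_indexSet (by omega) (by omega) (by omega))) _

theorem nine_mul_nine_pow (j : ℕ) : (9 : ZMod 24) * 9 ^ j = 9 := by
  induction j with
  | zero => simp
  | succ j ih => rw [pow_succ, ← mul_assoc, ih]; decide

theorem sixteen_mul_four_pow (i : ℕ) : (16 : ZMod 24) * 4 ^ i = 16 := by
  induction i with
  | zero => simp
  | succ i ih => rw [pow_succ, ← mul_assoc, ih]; decide

/-- The invariants attached to the index set span those of all divisors. -/
theorem invVec_mem {N : ℕ} (hN : 0 < N) {H : AddSubgroup Invariants}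
    (hH : ∀ b ∈ indexSet N, invVec N b ∈ H) {n : ℕ} (hn : n ∣ N) : invVec N n ∈ H := by
  induction n using Nat.strong_induction_on with
  | _ n ih =>
    have hn0 : 0 < n := Nat.pos_of_dvd_of_pos hn hN
    by_cases hp : ∃ p, p.Prime ∧ p ∣ n ∧ p ≠ 2 ∧ p ≠ 3
    · obtain ⟨p, hp, ⟨m, rfl⟩, hp2, hp3⟩ := hp
      obtain ⟨k, hk⟩ := hn
      have hm0 : 0 < m := Nat.pos_of_mul_pos_left hn0
      have hodd : p % 2 = 1 := (hp.eq_two_or_odd).resolve_left hp2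
      have h3 : p % 3 ≠ 0 := fun h => hp3
        ((Nat.prime_dvd_prime_iff_eq Nat.prime_three hp).mp (Nat.dvd_of_mod_eq_zero h)).symm
      have h24 : ((1 : ℤ) : ZMod 24) * (1 - (p : ZMod 24) ^ 2) = 0 := by
        have h := (ZMod.intCast_zmod_eq_zero_iff_dvd (1 - (p : ℤ) * p) 24).mpr
          (dvd_one_sub_sq (by omega) (by omega))
        push_cast at h ⊢
        linear_combination h
      have h2 : ((1 : ℤ) : ZMod 2) * ((p : ZMod 2) - 1) = 0 := by
        rw [(ZMod.natCast_eq_one_iff_odd).mpr (Nat.odd_iff.mpr hodd), sub_self, mul_zero]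
      -- Since p² ≡ 1 mod 24 and p is odd, twisted additivity holds with coefficient 1, and p splits
      -- off.
      have key := zsmul_invVec_mul (k := k) hp.pos hm0 1 h24 h2
      rw [← hk, one_smul, one_smul, one_mul] at key
      rw [key]
      have hpN : p ∈ N.primeFactors := Nat.mem_primeFactors.mpr
        ⟨hp, ⟨m * k, by rw [hk, mul_assoc]⟩, hN.ne'⟩
      refine H.add_mem (hH _ (prime_mem_indexSet hpN hp2 hp3))
        (H.zsmul_mem (ih m ?_ ⟨p * k, by rw [hk]; ring⟩) _)
      exact lt_mul_of_one_lt_left hm0 hp.one_lt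
    · push Not at hp
      obtain ⟨i, j, rfl⟩ : ∃ i j, n = 2 ^ i * 3 ^ j := by
        refine ⟨n.factorization 2, n.factorization 3, ?_⟩
        have hsub : n.primeFactors ⊆ {2, 3} := fun p hp' => by
          have := hp p (Nat.prime_of_mem_primeFactors hp') (Nat.dvd_of_mem_primeFactors hp')
          simp only [Finset.mem_insert, Finset.mem_singleton]
          tauto
        conv_lhs => rw [← Nat.prod_factorization_pow_eq_self hn0.ne']
        rw [Nat.prod_factorization_eq_prod_primeFactors, Finset.prod_subset hsub fun p _ hp => ?_,
          Finset.prod_pair (by norm_num)]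
        rw [← Nat.support_factorization, Finsupp.notMem_support_iff] at hp
        rw [hp, pow_zero]
      have hi : i ≤ N.factorization 2 := (Nat.prime_two.pow_dvd_iff_le_factorization hN.ne').mp
        ((Dvd.intro _ rfl).trans hn)
      have hj : j ≤ N.factorization 3 := (Nat.prime_three.pow_dvd_iff_le_factorization hN.ne').mp
        ((Dvd.intro_left _ rfl).trans hn)
      have mi := invVec_two_pow_mem hH hi
      have mj := invVec_three_pow_mem hH hj
      obtain ⟨k, hk⟩ := hn
      have hk' : N = 3 ^ j * 2 ^ i * k := by rw [hk]; ring
      -- Modulo 8 the square of 3^j is 1, so 3^j splits off; modulo 3 the square of 2^i is 1, so 2^i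
      -- does. The parity condition holds because 3^j is odd and 16 is even, respectively.
      refine mem_of_nine_smul_mem ?_ ?_
      · have key := zsmul_invVec_mul (m := 3 ^ j) (n := 2 ^ i) (k := k) (by positivity)
          (by positivity) 9 ?_ ?_
        · rw [← hk', mul_comm (3 ^ j)] at key
          rw [key]
          exact H.add_mem (H.zsmul_mem mj _) (H.zsmul_mem mi _)
        · have h := nine_mul_nine_pow j
          push_cast
          rw [← pow_mul, mul_comm j, pow_mul, show (3 : ZMod 24) ^ 2 = 9 by decide]
          linear_combination -h
        · push_cast
          rw [show (3 : ZMod 2) = 1 by decide]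
          simp
      · have key := zsmul_invVec_mul (m := 2 ^ i) (n := 3 ^ j) (k := k) (by positivity)
          (by positivity) 16 ?_ ?_
        · rw [← hk] at key
          rw [key]
          exact H.add_mem (H.zsmul_mem mi _) (H.zsmul_mem mj _)
        · have h := sixteen_mul_four_pow i
          push_cast
          rw [← pow_mul, mul_comm i, pow_mul, show (2 : ZMod 24) ^ 2 = 4 by decide]
          linear_combination -h
        · rw [show ((16 : ℤ) : ZMod 2) = 0 by decide, zero_mul]

end EtaChar

end

noncomputable section

namespace EtaChar

/-! ### Representatives -/

/-- The successive minimal leading coefficients of the kernel of `L` bound a unique representative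
of each coset of the kernel. -/
theorem existsUnique_reduced {t : ℕ} {G : Type*} [AddCommGroup G] (L : (Fin t → ℤ) →+ G)
    (htors : ∀ g : G, (24 : ℤ) • g = 0) (D : Fin t → ℕ)
    (hD : ∀ i, D i = sInf {m : ℕ | 1 ≤ m ∧ m ≤ 24 ∧ ∃ c : Fin t → ℤ, L c = 0 ∧
      (∀ j < i, c j = 0) ∧ c i = m}) (a : Fin t → ℤ) :
    ∃! c : Fin t → ℤ, (∀ j, 0 ≤ c j ∧ c j < D j) ∧ L c = L a := by
  have hmem : ∀ i, 1 ≤ D i ∧ D i ≤ 24 ∧ ∃ c : Fin t → ℤ, L c = 0 ∧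
      (∀ j < i, c j = 0) ∧ c i = D i := by
    intro i
    have hne : {m : ℕ | 1 ≤ m ∧ m ≤ 24 ∧ ∃ c : Fin t → ℤ, L c = 0 ∧
        (∀ j < i, c j = 0) ∧ c i = m}.Nonempty := by
      refine ⟨24, by norm_num, le_rfl, (24 : ℤ) • Pi.single i 1, ?_, fun j hj => ?_, ?_⟩
      · rw [map_zsmul, htors]
      · simp [hj.ne]
      · simp
    have := Nat.sInf_mem hne
    rw [← hD] at this
    exact this
  -- The bound m ≤ 24 loses nothing: a leading coefficient above 24 exceeds `D i` anyway.
  have hle : ∀ i, ∀ d : Fin t → ℤ, L d = 0 → (∀ j < i, d j = 0) → 0 < d i → (D i : ℤ) ≤ d i := by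
    intro i d hd h0 hpos
    by_contra hlt
    push Not at hlt
    obtain ⟨-, h24, -⟩ := hmem i
    have : D i ≤ (d i).toNat := by
      rw [hD i]
      exact Nat.sInf_le ⟨by omega, by omega, d, hd, h0, by omega⟩
    omega
  -- Coordinates are reduced from the left: a kernel vector with leading entry `D k` at k turns that
  -- coordinate into its remainder and leaves the earlier ones alone.
  have hex : ∀ k, k ≤ t → ∃ c : Fin t → ℤ, (∀ j : Fin t, j.val < k → 0 ≤ c j ∧ c j < D j) ∧
      L c = L a := by
    intro k
    induction k with
    | zero => exact fun _ => ⟨a, fun j hj => absurd hj (by omega), rfl⟩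
    | succ k ih =>
      intro hk
      obtain ⟨c, hc, hLc⟩ := ih (by omega)
      obtain ⟨h1, -, s, hs, hs0, hsi⟩ := hmem ⟨k, hk⟩
      refine ⟨c - (c ⟨k, hk⟩ / D ⟨k, hk⟩) • s, fun j hj => ?_, ?_⟩
      · rcases Nat.lt_succ_iff_lt_or_eq.mp hj with hj | hj
        · simpa [hs0 j hj] using hc j hj
        · obtain rfl : j = ⟨k, hk⟩ := Fin.ext hj
          have e : (c - (c ⟨k, hk⟩ / D ⟨k, hk⟩) • s) ⟨k, hk⟩ = c ⟨k, hk⟩ % D ⟨k, hk⟩ := by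
            rw [Int.emod_def, Pi.sub_apply, Pi.smul_apply, hsi, smul_eq_mul, mul_comm]
          rw [e]
          exact ⟨Int.emod_nonneg _ (by omega), Int.emod_lt_of_pos _ (by omega)⟩
      · rw [map_sub, map_zsmul, hs, smul_zero, sub_zero, hLc]
  obtain ⟨c, hc, hLc⟩ := hex t le_rfl
  refine ⟨c, ⟨fun j => hc j j.2, hLc⟩, ?_⟩
  rintro c' ⟨hc', hLc'⟩
  funext i
  -- If two reduced vectors agree before i, their difference is a kernel vector whose entry at i is
  -- smaller than `D i` in absolute value, hence 0 by minimality.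
  induction i using WellFoundedLT.induction with
  | _ i ih =>
    have b1 := hc i i.2
    have b2 := hc' i
    rcases lt_trichotomy (c' i) (c i) with h | h | h
    · have := hle i (c - c') (by rw [map_sub, hLc, hLc', sub_self])
        (fun j hj => by simp [ih j hj]) (by simpa using h)
      rw [Pi.sub_apply] at this
      omega
    · exact h
    · have := hle i (c' - c) (by rw [map_sub, hLc, hLc', sub_self])
        (fun j hj => by simp [ih j hj]) (by simpa using h)
      rw [Pi.sub_apply] at this
      omega

variable {N t : ℕ}

/-- The invariants of the vector with coordinates `c` in the index set. -/
def indexInvariant (b : Fin t ≃ indexSet N) : (Fin t → ℤ) →+ Invariants where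
  toFun c := ∑ j, c j • invVec N (b j)
  map_zero' := by simp
  map_add' c d := by simp [add_smul, Finset.sum_add_distrib]

theorem indexInvariant_apply (b : Fin t ≃ indexSet N) (c : Fin t → ℤ) :
    indexInvariant b c = ∑ j, c j • invVec N (b j) := rfl

theorem congruenceSystem_iff_indexInvariant (b : Fin t ≃ indexSet N) (c : ℕ → ℤ) :
    CongruenceSystem N c ↔ indexInvariant b (fun j => c (b j)) = 0 := by
  rw [congruenceSystem_iff, indexInvariant_apply,
    b.sum_comp (fun n : indexSet N => c n • invVec N n), ← Finset.sum_coe_sort]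

theorem Delta_eq (b : Fin t ≃ indexSet N) (i : Fin t) :
    Delta b i = sInf {m : ℕ | 1 ≤ m ∧ m ≤ 24 ∧ ∃ c : Fin t → ℤ, indexInvariant b c = 0 ∧
      (∀ j < i, c j = 0) ∧ c i = m} := by
  rw [Delta]
  congr 1
  ext m
  refine and_congr_right fun _ => and_congr_right fun _ => ⟨?_, ?_⟩
  · rintro ⟨c, hc, h⟩
    exact ⟨fun j => c (b j), (congruenceSystem_iff_indexInvariant b c).mp hc, h⟩
  · rintro ⟨c, hc, h⟩
    have hext : ∀ j, (fun n => if h : n ∈ indexSet N then c (b.symm ⟨n, h⟩) else 0) (b j : ℕ)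
        = c j := fun j => by simp
    refine ⟨fun n => if h : n ∈ indexSet N then c (b.symm ⟨n, h⟩) else 0, ?_, ?_, ?_⟩
    · rw [congruenceSystem_iff_indexInvariant b]
      simpa only [hext] using hc
    · intro j hj
      rw [hext, h.1 j hj]
    · rw [hext, h.2]

/-- The exponent vector `∑_j c_j e_{b_j} + (m - ∑_j c_j) e_1`. -/
def indexVec (b : Fin t ≃ indexSet N) (m : ℤ) (c : Fin t → ℤ) : Exponents N :=
  ∑ j, c j • basisVec N (b j) + (m - ∑ j, c j) • basisVec N 1

theorem sum_basisVec {n : ℕ} (hN : 0 < N) (hn : n ∣ N) : ∑ d, basisVec N n d = 1 := by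
  rw [Finset.sum_eq_single ⟨n, Nat.mem_divisors.mpr ⟨hn, hN.ne'⟩⟩]
  · simp [basisVec]
  · intro d _ hd
    rw [basisVec, if_neg fun h => hd (Subtype.ext h)]
  · simp

theorem invariant_basisVec {n : ℕ} (hN : 0 < N) (hn : n ∣ N) :
    invariant N (basisVec N n) = invVec N n := by
  rw [invariant_apply, Finset.sum_eq_single ⟨n, Nat.mem_divisors.mpr ⟨hn, hN.ne'⟩⟩]
  · simp [basisVec]
  · intro d _ hd
    rw [basisVec, if_neg fun h => hd (Subtype.ext h), zero_smul]
  · simp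

theorem index_dvd (b : Fin t ≃ indexSet N) (j : Fin t) : (b j : ℕ) ∣ N :=
  dvd_of_mem_indexSet (b j).2

theorem indexVec_mem_weightSet (hN : 0 < N) (b : Fin t ≃ indexSet N) (m : ℤ) (c : Fin t → ℤ) :
    indexVec b m c ∈ weightSet N m := by
  change ∑ n, indexVec b m c n = m
  simp only [indexVec, Pi.add_apply, Finset.sum_apply, Pi.smul_apply, smul_eq_mul]
  rw [Finset.sum_add_distrib, Finset.sum_comm, ← Finset.mul_sum, sum_basisVec hN (one_dvd N)]
  simp only [← Finset.mul_sum, sum_basisVec hN (index_dvd b _)]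
  simp

theorem invariant_indexVec (hN : 0 < N) (b : Fin t ≃ indexSet N) (m : ℤ) (c : Fin t → ℤ) :
    invariant N (indexVec b m c) = indexInvariant b c := by
  rw [indexVec, map_add, map_sum, map_zsmul, invariant_basisVec hN (one_dvd N), invVec_one,
    smul_zero, add_zero, indexInvariant_apply]
  refine Finset.sum_congr rfl fun j _ => ?_
  rw [map_zsmul, invariant_basisVec hN (index_dvd b j)]

theorem representatives_subset (hN : 0 < N) (b : Fin t ≃ indexSet N) (m : ℤ) :
    representatives b m ⊆ weightSet N m := by
  rintro v ⟨c, -, rfl⟩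
  exact indexVec_mem_weightSet hN b m c

theorem sum_sub_eq_zero {m : ℤ} {r s : Exponents N} (hr : r ∈ weightSet N m)
    (hs : s ∈ weightSet N m) : ∑ n, (r - s) n = 0 := by
  have hr' : ∑ n, r n = m := hr
  have hs' : ∑ n, s n = m := hs
  simp only [Pi.sub_apply, Finset.sum_sub_distrib, hr', hs', sub_self]

theorem sub_mem_Z_iff {m : ℤ} {r s : Exponents N} (hr : r ∈ weightSet N m)
    (hs : s ∈ weightSet N m) : r - s ∈ Z N ↔ invariant N r = invariant N s := by
  rw [mem_Z_iff (sum_sub_eq_zero hr hs), map_sub, sub_eq_zero]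

theorem invariant_mem_range (hN : 0 < N) (b : Fin t ≃ indexSet N) (r : Exponents N) :
    invariant N r ∈ (indexInvariant b).range := by
  rw [invariant_apply]
  refine AddSubgroup.sum_mem _ fun n _ => AddSubgroup.zsmul_mem _ ?_ _
  refine invVec_mem hN (fun d hd => ?_) (Nat.dvd_of_mem_divisors n.2)
  refine ⟨Pi.single (b.symm ⟨d, hd⟩) 1, ?_⟩
  rw [indexInvariant_apply, Finset.sum_eq_single (b.symm ⟨d, hd⟩)]
  · simp
  · intro j _ hj
    simp [hj]
  · simp

/-- The vectors of weight `m / 2` modulo `Z(N)` have unique representatives. -/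
theorem existsUnique_representative (hN : 0 < N) (b : Fin t ≃ indexSet N) {m : ℤ}
    {r : Exponents N} (hr : r ∈ weightSet N m) :
    ∃! v, v ∈ representatives b m ∧ r - v ∈ Z N := by
  obtain ⟨a, ha⟩ := invariant_mem_range hN b r
  obtain ⟨c, ⟨hc, hLc⟩, huniq⟩ := existsUnique_reduced (indexInvariant b) invariants_torsion
    (Delta b) (Delta_eq b) a
  refine ⟨indexVec b m c, ⟨⟨c, hc, rfl⟩, ?_⟩, ?_⟩
  · rw [sub_mem_Z_iff hr (indexVec_mem_weightSet hN b m c), invariant_indexVec hN, hLc, ha]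
  · rintro v ⟨⟨d, hd, hv⟩, hZ⟩
    change v = indexVec b m d at hv
    subst hv
    rw [sub_mem_Z_iff hr (indexVec_mem_weightSet hN b m d), invariant_indexVec hN, ← ha] at hZ
    rw [huniq d ⟨hd, hZ.symm⟩]

theorem etaChar_eq_iff_sub_mem_Z (hN : 0 < N) {m : ℤ} {r s : Exponents N}
    (hr : r ∈ weightSet N m) (hs : s ∈ weightSet N m) :
    etaChar r = etaChar s ↔ r - s ∈ Z N := by
  rw [etaChar_eq_iff, etaChar_eq_one_iff hN (sum_sub_eq_zero hr hs)]

theorem etaCharacters_eq_image (N : ℕ) (m : ℤ) : etaCharacters N m = etaChar '' weightSet N m := by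
  ext χ
  constructor
  · rintro ⟨r, hr, h⟩
    exact ⟨r, hr, (isCharacterOf_iff.mp h).symm⟩
  · rintro ⟨r, hr, rfl⟩
    exact ⟨r, hr, isCharacterOf_iff.mpr rfl⟩

theorem ncard_image_eq {α β γ : Type*} {s : Set α} {f : α → β} {g : α → γ}
    (h : ∀ x ∈ s, ∀ y ∈ s, f x = f y ↔ g x = g y) : (f '' s).ncard = (g '' s).ncard := by
  classical
  have hinv : ∀ y : f '' s, ∃ x ∈ s, f x = y := fun y => y.2
  choose k hks hk using hinv
  refine Set.ncard_congr (fun y hy => g (k ⟨y, hy⟩)) (fun y hy => ⟨_, hks _, rfl⟩) ?_ ?_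
  · intro y z hy hz hyz
    have := (h _ (hks _) _ (hks _)).mpr hyz
    rwa [hk, hk] at this
  · rintro _ ⟨x, hx, rfl⟩
    exact ⟨f x, ⟨x, hx, rfl⟩, (h _ (hks _) _ hx).mp (hk _)⟩

/-- In a fixed weight, characters and invariants identify the same vectors. Adding multiples of e_1
reaches any weight without changing the invariant. -/
theorem ncard_etaCharacters (hN : 0 < N) (m : ℤ) :
    (etaCharacters N m).ncard = ((invariant N).range : Set Invariants).ncard := by
  rw [etaCharacters_eq_image, ncard_image_eq (g := invariant N) fun r hr s hs => by
    rw [etaChar_eq_iff_sub_mem_Z hN hr hs, sub_mem_Z_iff hr hs]]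
  congr 1
  ext g
  constructor
  · rintro ⟨r, -, rfl⟩
    exact ⟨r, rfl⟩
  · rintro ⟨r, rfl⟩
    refine ⟨r + (m - ∑ n, r n) • basisVec N 1, ?_, ?_⟩
    · change ∑ n, (r n + (m - ∑ n, r n) * basisVec N 1 n) = m
      rw [Finset.sum_add_distrib, ← Finset.mul_sum, sum_basisVec hN (one_dvd N)]
      ring
    · rw [map_add, map_zsmul, invariant_basisVec hN (one_dvd N), invVec_one, smul_zero, add_zero]

end EtaChar

end

noncomputable section

namespace EtaChar

/-! ### Levels that are powers of two -/

/-- A parametrization of the invariants occurring in level `2 ^ a`. -/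
def twoPowerParam (a : ℕ) (x : ZMod 24 × ZMod 8 × ZMod 2) : Invariants :=
  (x.1, 2 ^ a * x.1 + 3 * (x.2.1.val : ZMod 24), Pi.single 2 x.2.2)

theorem twoPowerParam_injective (a : ℕ) : Function.Injective (twoPowerParam a) := by
  rintro ⟨x, y, z⟩ ⟨x', y', z'⟩ h
  simp only [twoPowerParam, Prod.mk.injEq] at h
  obtain ⟨rfl, h2, h3⟩ := h
  have h8 : ∀ y y' : ZMod 8, 3 * (y.val : ZMod 24) = 3 * (y'.val : ZMod 24) → y = y' := by decide
  rw [h8 y y' (add_left_cancel h2), Pi.single_injective 2 h3]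

theorem ncard_range_twoPowerParam (a : ℕ) : (Set.range (twoPowerParam a)).ncard = 384 := by
  rw [← Set.image_univ, Set.ncard_image_of_injective _ (twoPowerParam_injective a),
    Set.ncard_univ, Nat.card_prod, Nat.card_prod, Nat.card_zmod, Nat.card_zmod, Nat.card_zmod]

/-- The relations between the invariants in level `2 ^ a`. -/
def twoPowerSubgroup (a : ℕ) : AddSubgroup Invariants where
  carrier := {g | (∃ w, g.2.1 = 2 ^ a * g.1 + 3 * w) ∧ ∀ p, p ≠ 2 → g.2.2 p = 0}
  zero_mem' := ⟨⟨0, by simp⟩, fun p _ => rfl⟩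
  add_mem' := by
    rintro g h ⟨⟨w, hw⟩, hg⟩ ⟨⟨w', hw'⟩, hh⟩
    refine ⟨⟨w + w', ?_⟩, fun p hp => ?_⟩
    · rw [invariants_add_snd_fst, invariants_add_fst, hw, hw']
      ring
    · rw [invariants_add_snd_snd, hg p hp, hh p hp, add_zero]
  neg_mem' := by
    rintro g ⟨⟨w, hw⟩, hg⟩
    refine ⟨⟨-w, ?_⟩, fun p hp => ?_⟩
    · change -g.2.1 = 2 ^ a * -g.1 + 3 * -w
      rw [hw]
      ring
    · change -g.2.2 p = 0
      rw [hg p hp, neg_zero]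

/-- Since 4^β ≡ 1 mod 3, one has 2^{a-β} ≡ 2^a · 2^β mod 3, so the second invariant is 2^a times the
first modulo 3. -/
theorem invVec_mem_twoPowerSubgroup {a β : ℕ} (h : β ≤ a) :
    invVec (2 ^ a) (2 ^ β) ∈ twoPowerSubgroup a := by
  obtain ⟨k, rfl⟩ := Nat.exists_eq_add_of_le h
  obtain ⟨w, hw⟩ : ∃ w : ZMod 24, (4 : ZMod 24) ^ β = 1 + 3 * w := by
    clear h
    induction β with
    | zero => exact ⟨0, by simp⟩
    | succ β ih =>
      obtain ⟨w, hw⟩ := ih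
      exact ⟨1 + 4 * w, by rw [pow_succ, hw]; ring⟩
  have hw' : (2 : ZMod 24) ^ β * 2 ^ β = 1 + 3 * w := by
    rw [← hw, ← mul_pow]
    norm_num
  refine ⟨⟨-(2 ^ k * w), ?_⟩, fun p hp => ?_⟩
  · simp only [invVec]
    rw [pow_add, Nat.mul_div_cancel_left _ (by positivity)]
    push_cast
    linear_combination (-(2 : ZMod 24) ^ k) * hw'
  · simp [invVec, Nat.prime_two.factorization_pow, Finsupp.single_eq_of_ne hp]

theorem twoPowerSubgroup_subset_range (a : ℕ) :
    (twoPowerSubgroup a : Set Invariants) ⊆ Set.range (twoPowerParam a) := by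
  rintro ⟨x, y, z⟩ ⟨⟨w, hw⟩, hz⟩
  have h3 : ∀ w : ZMod 24, 3 * (((w.val : ZMod 8).val : ℕ) : ZMod 24) = 3 * w := by decide
  refine ⟨(x, (w.val : ZMod 8), z 2), invariants_ext rfl ?_ fun p => ?_⟩
  · change 2 ^ a * x + 3 * (((w.val : ZMod 8).val : ℕ) : ZMod 24) = y
    rw [h3]
    exact hw.symm
  · change (Pi.single 2 (z 2) : ℕ → ZMod 2) p = z p
    rcases eq_or_ne p 2 with rfl | hp
    · simp
    · rw [Pi.single_eq_of_ne hp]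
      exact (hz p hp).symm

theorem zsmul_invariants (e : ℤ) (x y : ZMod 24) (z : ZMod 2) :
    e • ((x, y, Pi.single 2 z) : Invariants)
      = ((e * x, e * y, Pi.single 2 (e * z)) : ZMod 24 × ZMod 24 × (ℕ → ZMod 2)) := by
  refine invariants_ext ?_ ?_ fun p => ?_
  · exact zsmul_eq_mul x e
  · exact zsmul_eq_mul y e
  · change e • (Pi.single 2 z : ℕ → ZMod 2) p = (Pi.single 2 (e * z) : ℕ → ZMod 2) p
    rcases eq_or_ne p 2 with rfl | hp
    · simp
    · simp [hp]

theorem invVec_two_pow (a β : ℕ) (h : β ≤ a) : invVec (2 ^ a) (2 ^ β) =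
    ((2 ^ β - 1, 2 ^ (a - β) - 2 ^ a, Pi.single 2 (β : ZMod 2)) :
      ZMod 24 × ZMod 24 × (ℕ → ZMod 2)) := by
  refine invariants_ext ?_ ?_ fun p => ?_
  · simp [invVec]
  · simp only [invVec]
    rw [Nat.pow_div h (by norm_num)]
    push_cast
    ring
  · simp only [invVec, Nat.prime_two.factorization_pow]
    rcases eq_or_ne p 2 with rfl | hp
    · simp
    · simp [Finsupp.single_eq_of_ne hp, hp]

theorem range_invariant_two_pow (l : ℕ) :
    ((invariant (2 ^ (l + 3))).range : Set Invariants) = Set.range (twoPowerParam (l + 3)) := by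
  have hN : 0 < 2 ^ (l + 3) := by positivity
  apply Set.Subset.antisymm
  · refine Set.Subset.trans ?_ (twoPowerSubgroup_subset_range _)
    rintro _ ⟨r, rfl⟩
    rw [invariant_apply]
    refine AddSubgroup.sum_mem _ fun n _ => AddSubgroup.zsmul_mem _ ?_ _
    obtain ⟨β, hβ, h⟩ := (Nat.dvd_prime_pow Nat.prime_two).mp (Nat.dvd_of_mem_divisors n.2)
    rw [h]
    exact invVec_mem_twoPowerSubgroup hβ
  · rintro _ ⟨⟨x, y, z⟩, rfl⟩
    have hmem : ∀ β ≤ l + 3, invVec (2 ^ (l + 3)) (2 ^ β) ∈ (invariant (2 ^ (l + 3))).range :=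
      fun β hβ => ⟨basisVec _ (2 ^ β), invariant_basisVec hN (pow_dvd_pow 2 hβ)⟩
    have h9 := fun t s => nine_smul_mem (l := l) (M := 1)
      (by rw [mul_one]; exact hmem (l + 1) (by omega))
      (by rw [mul_one]; exact hmem (l + 2) (by omega))
      (by rw [mul_one]; exact hmem (l + 3) le_rfl) t s
    have hC := hmem (l + 3) le_rfl
    have h1 := hmem 1 (by omega)
    rw [invVec_two_pow _ _ le_rfl] at hC
    rw [invVec_two_pow _ _ (by omega), show l + 3 - 1 = l + 2 by omega] at h1
    change ((x, 2 ^ (l + 3) * x + 3 * (y.val : ZMod 24), Pi.single 2 z) :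
      ZMod 24 × ZMod 24 × (ℕ → ZMod 2)) ∈ _
    generalize (y.val : ZMod 24) = w
    have h72 : (72 : ZMod 24) = 0 := by decide
    have h48 : (48 : ZMod 24) = 0 := by decide
    refine mem_of_nine_smul_mem ?_ ?_
    -- As 1 - 2^{l+3} ≡ 1 mod 8, Y copies of the invariant of 2^{l+3} give the second component; T
    -- and V then correct the first component and the parity.
    · obtain ⟨Y, hY⟩ := ZMod.intCast_surjective (2 ^ (l + 3) * x + 3 * w)
      obtain ⟨T, hT⟩ := ZMod.intCast_surjective (x - (Y : ZMod 24) * (2 ^ (l + 3) - 1))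
      obtain ⟨V, hV⟩ := ZMod.intCast_surjective
        (9 * z - 9 * (Y : ZMod 2) * ((l + 3 : ℕ) : ZMod 2))
      have key := AddSubgroup.add_mem _ (AddSubgroup.zsmul_mem _ hC (9 * Y)) (h9 T V)
      convert key using 1
      rw [zsmul_invariants, zsmul_invariants, hT, hV, ← hY]
      refine invariants_ext ?_ ?_ fun p => ?_
      · rw [invariants_add_fst]
        push_cast
        ring
      · rw [invariants_add_snd_fst]
        push_cast
        rw [Nat.sub_self]
        linear_combination ((Y : ZMod 24) * 2 ^ l) * h72
      · rw [invariants_add_snd_snd]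
        rcases eq_or_ne p 2 with rfl | hp
        · simp
        · simp [hp]
    -- The part modulo 3 is generated by the invariant of 2, whose first component is 1.
    · obtain ⟨X, rfl⟩ := ZMod.intCast_surjective x
      have key := AddSubgroup.zsmul_mem _ h1 (16 * X)
      convert key using 1
      have h16 : (16 : ZMod 2) = 0 := by decide
      rw [zsmul_invariants, zsmul_invariants]
      refine invariants_ext ?_ ?_ fun p => ?_
      · push_cast
        ring
      · push_cast
        linear_combination ((X : ZMod 24) * 4 * 2 ^ l + w) * h48
      · push_cast
        rw [h16]
        simp

theorem ncard_etaCharacters_two_pow {a : ℕ} (ha : 3 ≤ a) (m : ℤ) :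
    (etaCharacters (2 ^ a) m).ncard = 384 := by
  obtain ⟨l, rfl⟩ := Nat.exists_eq_add_of_le' ha
  rw [ncard_etaCharacters (by positivity), range_invariant_two_pow, ncard_range_twoPowerParam]

end EtaChar

end

/-! ### Assembly of the theorem -/

theorem corollary6p6 :
    (∀ (N : ℕ), 0 < N →
      -- each eta-quotient has exactly one character, and two eta-quotients of equal weight have
      -- the same character exactly if their exponent vectors agree modulo `Z(N)`
      (∀ r : EtaChar.Exponents N, ∃! χ : EtaChar.Gamma0Cover N →* Circle,
        EtaChar.IsCharacterOf χ r) ∧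
      (∀ (m : ℤ), ∀ r ∈ EtaChar.weightSet N m, ∀ r' ∈ EtaChar.weightSet N m,
        ∀ χ χ' : EtaChar.Gamma0Cover N →* Circle,
          EtaChar.IsCharacterOf χ r → EtaChar.IsCharacterOf χ' r' →
            (χ = χ' ↔ r - r' ∈ EtaChar.Z N)) ∧
      -- for every ordering of the index set:
      ∀ (t : ℕ) (b : Fin t ≃ EtaChar.indexSet N),
        -- a complete system of representatives of `S(N) / Z(N)`
        (EtaChar.representatives b 0 ⊆ (EtaChar.S N : Set (EtaChar.Exponents N)) ∧
          ∀ x : EtaChar.CharQuotient N, ∃! v : EtaChar.S N,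
            (v : EtaChar.Exponents N) ∈ EtaChar.representatives b 0 ∧
              (QuotientAddGroup.mk v : EtaChar.CharQuotient N) = x) ∧
        -- the one-to-one correspondence in every weight `k = m / 2`
        (∀ m : ℤ,
          (∀ v ∈ EtaChar.representatives b m,
            ∃! χ, χ ∈ EtaChar.etaCharacters N m ∧ EtaChar.IsCharacterOf χ v) ∧
          (∀ χ ∈ EtaChar.etaCharacters N m,
            ∃! v, v ∈ EtaChar.representatives b m ∧ EtaChar.IsCharacterOf χ v))) ∧
    -- the number of characters for `Γ₀(2 ^ α)`
    (∀ α : ℕ, 3 ≤ α → ∀ m : ℤ, (EtaChar.etaCharacters (2 ^ α) m).ncard = 384) := by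
  refine ⟨fun N hN => ⟨fun r => ?_, fun m r hr r' hr' χ χ' hχ hχ' => ?_, fun t b => ⟨⟨?_, ?_⟩, ?_⟩⟩,
    fun α hα m => EtaChar.ncard_etaCharacters_two_pow hα m⟩
  · exact ⟨EtaChar.etaChar r, EtaChar.isCharacterOf_iff.mpr rfl,
      fun χ h => EtaChar.isCharacterOf_iff.mp h⟩
  · rw [EtaChar.isCharacterOf_iff.mp hχ, EtaChar.isCharacterOf_iff.mp hχ']
    exact EtaChar.etaChar_eq_iff_sub_mem_Z hN hr hr'
  · exact EtaChar.representatives_subset hN b 0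
  · intro x
    obtain ⟨r, rfl⟩ := QuotientAddGroup.mk_surjective x
    obtain ⟨v, ⟨hv, hrv⟩, huniq⟩ := EtaChar.existsUnique_representative hN b (m := 0) r.2
    have hmk : ∀ w : EtaChar.S N, (QuotientAddGroup.mk w : EtaChar.CharQuotient N)
        = QuotientAddGroup.mk r ↔ (r : EtaChar.Exponents N) - w ∈ EtaChar.Z N := fun w => by
      rw [QuotientAddGroup.eq, AddSubgroup.mem_addSubgroupOf, AddSubgroup.coe_add,
        AddSubgroup.coe_neg, neg_add_eq_sub]
    refine ⟨⟨v, EtaChar.representatives_subset hN b 0 hv⟩, ⟨hv, (hmk _).mpr hrv⟩, ?_⟩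
    rintro w ⟨hw, hwr⟩
    exact Subtype.ext (huniq w ⟨hw, (hmk w).mp hwr⟩)
  · refine fun m => ⟨fun v hv => ?_, ?_⟩
    · refine ⟨EtaChar.etaChar v, ⟨⟨v, EtaChar.representatives_subset hN b m hv,
        EtaChar.isCharacterOf_iff.mpr rfl⟩, EtaChar.isCharacterOf_iff.mpr rfl⟩, ?_⟩
      exact fun χ h => EtaChar.isCharacterOf_iff.mp h.2
    · rintro χ ⟨r, hr, hχ⟩
      rw [EtaChar.isCharacterOf_iff] at hχ
      subst hχ
      obtain ⟨v, ⟨hv, hrv⟩, huniq⟩ := EtaChar.existsUnique_representative hN b hr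
      refine ⟨v, ⟨hv, EtaChar.isCharacterOf_iff.mpr ((EtaChar.etaChar_eq_iff_sub_mem_Z hN hr
        (EtaChar.representatives_subset hN b m hv)).mpr hrv)⟩, ?_⟩
      rintro w ⟨hw, hwχ⟩
      exact huniq w ⟨hw, (EtaChar.etaChar_eq_iff_sub_mem_Z hN hr
        (EtaChar.representatives_subset hN b m hw)).mp (EtaChar.isCharacterOf_iff.mp hwχ)⟩
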